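/- **Setting.** For each $n\ge 1$ let $X=X_n\in\mathbb R^{n\times p}$, $p=p(n)$, be a random right-rotationally invariant matrix (i.e. $XO\stackrel{d}{=}X$ for every orthogonal $O\in\mathbb R^{p\times p}$), let $\beta=\beta_n\in\mathbb R^{p}$ be deterministic or random, independent of $X_n$, with $\|\beta_n\|/\sqrt n=r$ almost surely, and let $y=y_n=X_n\beta_n+\varepsilon_n$, where $\varepsilon_n\in\mathbb R^n$ is independent of $(X_n,\beta_n)$ and has independent entries with mean $0$, variance $\sigma^2$ and $\sup_{n,i}\mathbb E|\varepsilon_{n,i}|^{4+\eta}<\infty$ for some $\eta>0$. All variables live on one probability space; no assumption is made on the joint law for different $n$. Assume $p(n)/n\to\gamma\in[0,\infty)$ and $p(n)/\log n\to\infty$ (the latter is automatic if $\gamma>0$), and that for some constant $C$ the largest singular value satisfies $\limsup_n\sigma_{\max}(X_n)<C$ almost surely. Let $\mu_n$ be the empirical distribution of the $n$ eigenvalues of $X_nX_n^\top$, let $v_n(z)=\int (x-z)^{-1}\,d\mu_n(x)$, and put $\gamma_n=p(n)/n$. Assume that the spectrum is nondegenerate in the sense that almost surely $\liminf_n \gamma_n^{-1}\operatorname{Var}(\mu_n)>0$,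 where $\operatorname{Var}(\mu_n)$ is the variance of the distribution $\mu_n$. **Estimators.** Fix a finite grid $\lambda_1,\dots,\lambda_L>0$, not all equal. With $\hat\beta_\lambda=\arg\min_b\{\|y-Xb\|^2+\lambda\|b\|^2\}=(X^\top X+\lambda I)^{-1}X^\top y$ put $$a_i=\frac{\lambda_i^2}{\gamma_n}\bigl(v_n(-\lambda_i)-\lambda_i v_n'(-\lambda_i)\bigr),\qquad b_i=\lambda_i^2v_n'(-\lambda_i),\qquad t_i=\tfrac1n\|y-X\hat\beta_{\lambda_i}\|^2,$$ $$\hat\sigma^2_n=\frac{\sum_{i=1}^L\bigl(\frac{t_i}{a_i}-\frac{t_1}{a_1}\bigr)\bigl(\frac{b_i}{a_i}-\frac{b_1}{a_1}\bigr)}{\sum_{i=1}^L\bigl(\frac{b_i}{a_i}-\frac{b_1}{a_1}\bigr)^2},\qquad \hat r^2_n=\frac{\sum_{i=1}^L\bigl(\frac{t_i}{b_i}-\frac{t_1}{b_1}\bigr)\bigl(\frac{a_i}{b_i}-\frac{a_1}{b_1}\bigr)}{\sum_{i=1}^L\bigl(\frac{a_i}{b_i}-\frac{a_1}{b_1}\bigr)^2}.$$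 **Claim.** $\hat r^2_n$ and $\hat\sigma^2_n$ are strongly consistent: almost surely $\hat r^2_n\to r^2$ and $\hat\sigma^2_n\to\sigma^2$ as $n\to\infty$. -/

import Mathlib

open MeasureTheory ProbabilityTheory Filter Topology
open scoped Matrix ENNReal NNReal

noncomputable section

/-- Matrices carry the product (that is, Borel) measurable structure of their entries. -/
instance matrixMeasurableSpace {m k : Type*} : MeasurableSpace (Matrix m k ℝ) :=
  inferInstanceAs (MeasurableSpace (m → k → ℝ))

/-- `X` is right-rotationally invariant: `X O` and `X` have the same law for every orthogonal `O`. -/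
def RightRotationallyInvariant {Ω : Type*} [MeasurableSpace Ω] {n p : ℕ}
    (X : Ω → Matrix (Fin n) (Fin p) ℝ) (P : Measure Ω) : Prop :=
  ∀ O ∈ Matrix.orthogonalGroup (Fin p) ℝ, IdentDistrib (fun ω => X ω * O) X P P

theorem isHermitian_mul_transpose {n p : ℕ} (X : Matrix (Fin n) (Fin p) ℝ) :
    (X * Xᵀ).IsHermitian := by
  simpa using Matrix.isHermitian_mul_conjTranspose_self X

/-- The `n` eigenvalues of `X Xᵀ`, that is, the diagonal entries of `D Dᵀ` for a singular value
decomposition `X = Qᵀ D O`. -/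
def companionEigenvalue {n p : ℕ} (X : Matrix (Fin n) (Fin p) ℝ) (i : Fin n) : ℝ :=
  (isHermitian_mul_transpose X).eigenvalues i

/-- The empirical distribution of the eigenvalues of `X Xᵀ`. -/
def companionSpectralMeasure {n p : ℕ} (X : Matrix (Fin n) (Fin p) ℝ) : Measure ℝ :=
  (n : ℝ≥0∞)⁻¹ • ∑ i, Measure.dirac (companionEigenvalue X i)

/-- The largest singular value of `X`. -/
def maxSingularValue {n p : ℕ} (X : Matrix (Fin n) (Fin p) ℝ) : ℝ≥0∞ :=
  ⨆ i, ENNReal.ofReal √(companionEigenvalue X i)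

/-- The Stieltjes transform of `μ` at a real point `z` (outside the support of `μ`). -/
def stieltjes (μ : Measure ℝ) (z : ℝ) : ℝ := ∫ x, (x - z)⁻¹ ∂μ

/-- The companion Stieltjes transform `v_D`. -/
def companionStieltjes {n p : ℕ} (X : Matrix (Fin n) (Fin p) ℝ) (z : ℝ) : ℝ :=
  stieltjes (companionSpectralMeasure X) z

/-- The ridge objective `‖y - X b‖² + lam ‖b‖²`, with Euclidean norms. -/
def ridgeObjective {n p : ℕ} (X : Matrix (Fin n) (Fin p) ℝ) (y : Fin n → ℝ) (lam : ℝ)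
    (b : Fin p → ℝ) : ℝ :=
  ‖WithLp.toLp 2 (y - X *ᵥ b)‖ ^ 2 + lam * ‖WithLp.toLp 2 b‖ ^ 2

/-- The ridge estimator, in closed form; for `lam > 0` it is the unique minimizer of
`ridgeObjective X y lam` (see `ridgeObjective_ridge_lt`). -/
def ridge {n p : ℕ} (X : Matrix (Fin n) (Fin p) ℝ) (y : Fin n → ℝ) (lam : ℝ) : Fin p → ℝ :=
  (Xᵀ * X + lam • (1 : Matrix (Fin p) (Fin p) ℝ))⁻¹ *ᵥ (Xᵀ *ᵥ y)

theorem ridgeObjective_ridge_lt {n p : ℕ} (X : Matrix (Fin n) (Fin p) ℝ) (y : Fin n → ℝ)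
    {lam : ℝ} (hlam : 0 < lam) (b : Fin p → ℝ) (hb : b ≠ ridge X y lam) :
    ridgeObjective X y lam (ridge X y lam) < ridgeObjective X y lam b := by
  have hsq : ∀ {m : ℕ} (v : Fin m → ℝ), ‖WithLp.toLp 2 v‖ ^ 2 = v ⬝ᵥ v := by
    intro m v
    rw [EuclideanSpace.norm_sq_eq]
    simp [dotProduct, sq]
  have hpd : (Xᵀ * X + lam • (1 : Matrix (Fin p) (Fin p) ℝ)).PosDef := by
    refine Matrix.PosDef.posSemidef_add ?_ ?_
    · simpa using Matrix.posSemidef_conjTranspose_mul_self X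
    · exact Matrix.PosDef.one.smul hlam
  set c := ridge X y lam with hc
  have hnorm : Xᵀ *ᵥ (X *ᵥ c) + lam • c = Xᵀ *ᵥ y := by
    have h1 : (Xᵀ * X + lam • (1 : Matrix (Fin p) (Fin p) ℝ)) *ᵥ c = Xᵀ *ᵥ y := by
      rw [hc, ridge, Matrix.mulVec_mulVec,
        Matrix.mul_nonsing_inv _ ((Matrix.isUnit_iff_isUnit_det _).1 hpd.isUnit), Matrix.one_mulVec]
    rw [← h1, Matrix.add_mulVec, Matrix.smul_mulVec, Matrix.one_mulVec, Matrix.mulVec_mulVec]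
  obtain ⟨d, rfl⟩ : ∃ d, b = c + d := ⟨b - c, by abel⟩
  have hd : d ≠ 0 := by
    rintro rfl
    simp at hb
  have hdd : 0 < d ⬝ᵥ d := by
    rw [← hsq]
    have : WithLp.toLp 2 d ≠ 0 := by simpa using hd
    positivity
  have hX : 0 ≤ (X *ᵥ d) ⬝ᵥ (X *ᵥ d) := by
    rw [← hsq]
    positivity
  have hcross : d ⬝ᵥ (Xᵀ *ᵥ (X *ᵥ c)) + lam * (d ⬝ᵥ c) = d ⬝ᵥ (Xᵀ *ᵥ y) := by
    rw [← hnorm, dotProduct_add, dotProduct_smul, smul_eq_mul]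
  have htr : ∀ w : Fin n → ℝ, d ⬝ᵥ (Xᵀ *ᵥ w) = (X *ᵥ d) ⬝ᵥ w := by
    intro w
    rw [Matrix.dotProduct_mulVec, Matrix.vecMul_transpose]
  rw [htr, htr] at hcross
  simp only [ridgeObjective, hsq, Matrix.mulVec_add, dotProduct_add, add_dotProduct,
    dotProduct_sub, sub_dotProduct]
  have e1 := dotProduct_comm y (X *ᵥ d)
  have e2 := dotProduct_comm (X *ᵥ c) (X *ᵥ d)
  have e3 := dotProduct_comm c d
  have e4 : 0 < lam * (d ⬝ᵥ d) := mul_pos hlam hdd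
  rw [e1, e2, e3]
  linarith

/-- The coefficient of `r²` in the estimating equation at `lam`, with `γ = p / n`. -/
def coefA {n p : ℕ} (X : Matrix (Fin n) (Fin p) ℝ) (lam : ℝ) : ℝ :=
  lam ^ 2 / ((p : ℝ) / n) *
    (companionStieltjes X (-lam) - lam * deriv (companionStieltjes X) (-lam))

/-- The coefficient of `σ²` in the estimating equation at `lam`. -/
def coefB {n p : ℕ} (X : Matrix (Fin n) (Fin p) ℝ) (lam : ℝ) : ℝ :=
  lam ^ 2 * deriv (companionStieltjes X) (-lam)

/-- The training error `‖y - X β̂‖² / n` of the ridge estimator. -/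
def trainError {n p : ℕ} (X : Matrix (Fin n) (Fin p) ℝ) (y : Fin n → ℝ) (lam : ℝ) : ℝ :=
  ‖WithLp.toLp 2 (y - X *ᵥ ridge X y lam)‖ ^ 2 / n

/-- The least-squares estimator of `σ²` on the grid `lam 0, …, lam L`: the slope of `t / a` against
`b / a`, both centred at the first grid point. -/
def sigmaSqHat {n p L : ℕ} (lam : Fin (L + 1) → ℝ) (X : Matrix (Fin n) (Fin p) ℝ)
    (y : Fin n → ℝ) : ℝ :=
  let a := fun i => coefA X (lam i)
  let b := fun i => coefB X (lam i)
  let t := fun i => trainError X y (lam i)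
  (∑ i, (t i / a i - t 0 / a 0) * (b i / a i - b 0 / a 0)) /
    ∑ i, (b i / a i - b 0 / a 0) ^ 2

/-- The least-squares estimator of `r²` on the grid `lam 0, …, lam L`: the slope of `t / b` against
`a / b`, both centred at the first grid point. -/
def rSqHat {n p L : ℕ} (lam : Fin (L + 1) → ℝ) (X : Matrix (Fin n) (Fin p) ℝ)
    (y : Fin n → ℝ) : ℝ :=
  let a := fun i => coefA X (lam i)
  let b := fun i => coefB X (lam i)
  let t := fun i => trainError X y (lam i)
  (∑ i, (t i / b i - t 0 / b 0) * (a i / b i - a 0 / b 0)) /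
    ∑ i, (a i / b i - a 0 / b 0) ^ 2

end

/-! ### The resolvent of the companion Gram matrix -/

/-! With R = (XXᵀ + λ)⁻¹, the normal equations turn the ridge residual into λ R y, so the training
error is λ²‖R(Xβ + ε)‖²/n. It splits into a signal form βᵀMβ with M = XᵀR²X, a cross term and a
noise form εᵀR²ε. Since a is λ² tr M / p and b is λ² tr R² / n, `trainError_sub_eq` writes t − (r²a
+ σ²b) exactly as λ² times three centred errors, which are shown to vanish almost surely.

Signal: XXᵀ is unchanged by right rotations, so for fixed β the law of βᵀMβ depends only on ‖β‖. The
vector β may thus be replaced by an independent Gaussian one, and a chi-square Chernoff bound gives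
concentration at tr M / p with error exp(−cp), summable because p/log n → ∞
(`measure_quadraticForm_le_of_invariant`). Cross term: given (X, β) it is a linear form in ε, and a
fourth moment bound suffices. Noise: the off-diagonal part has fourth moment O(n²). The diagonal
part is truncated at n^α, and the moment of order 4 + η pays for the truncation
(`measure_noise_quadraticForm_le`). Each tail bound is uniform in the frozen variables, so
independence and Fubini make it unconditional. Borel–Cantelli then uses only the law at each n.

It remains to solve t ≈ r²a + σ²b. Dividing by a and centring at the first grid point removes r²,
and the least-squares slope recovers σ²; exchanging a and b recovers r² (`tendsto_slope`). This is
stable if a and b stay away from 0 and ∞ and a_j b_0 − a_0 b_j stays away from 0. Symmetrizing that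
determinant over pairs of eigenvalues bounds it below by a multiple of Var(μ_n)/γ_n
(`le_coef_cross`), which is where the bounded spectrum and its nondegeneracy enter. -/

instance matrixBorelSpace {m k : Type*} [Finite m] [Finite k] : BorelSpace (Matrix m k ℝ) :=
  haveI := Fintype.ofFinite m
  haveI := Fintype.ofFinite k
  inferInstanceAs (BorelSpace (m → k → ℝ))

/-- The resolvent `(X Xᵀ + lam)⁻¹`. -/
noncomputable def gramResolvent {n p : ℕ} (X : Matrix (Fin n) (Fin p) ℝ) (lam : ℝ) : Matrix (Fin n) (Fin n) ℝ :=
  (X * Xᵀ + lam • (1 : Matrix (Fin n) (Fin n) ℝ))⁻¹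

/-- The matrix `Xᵀ (X Xᵀ + lam)⁻² X` of the quadratic form in the signal. -/
noncomputable def signalMatrix {n p : ℕ} (X : Matrix (Fin n) (Fin p) ℝ) (lam : ℝ) : Matrix (Fin p) (Fin p) ℝ :=
  Xᵀ * (gramResolvent X lam * gramResolvent X lam) * X

section LinearAlgebra

variable {n p : ℕ}

theorem norm_toLp_sq {m : ℕ} (v : Fin m → ℝ) : ‖WithLp.toLp 2 v‖ ^ 2 = v ⬝ᵥ v := by
  rw [EuclideanSpace.norm_sq_eq]
  simp [dotProduct, sq]

theorem dotProduct_self_nonneg' {m : ℕ} (v : Fin m → ℝ) : 0 ≤ v ⬝ᵥ v := by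
  rw [← norm_toLp_sq]
  positivity

theorem isUnit_det_gram (X : Matrix (Fin n) (Fin p) ℝ) {lam : ℝ} (hlam : 0 < lam) :
    IsUnit (X * Xᵀ + lam • (1 : Matrix (Fin n) (Fin n) ℝ)).det := by
  have hpd : (X * Xᵀ + lam • (1 : Matrix (Fin n) (Fin n) ℝ)).PosDef := by
    refine Matrix.PosDef.posSemidef_add ?_ ?_
    · simpa using Matrix.posSemidef_self_mul_conjTranspose X
    · exact Matrix.PosDef.one.smul hlam
  exact (Matrix.isUnit_iff_isUnit_det _).1 hpd.isUnit

theorem gramResolvent_transpose (X : Matrix (Fin n) (Fin p) ℝ) (lam : ℝ) :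
    (gramResolvent X lam)ᵀ = gramResolvent X lam := by
  rw [gramResolvent, Matrix.transpose_nonsing_inv]
  congr 1
  simp [Matrix.transpose_mul]

theorem gram_mulVec_gramResolvent_mulVec (X : Matrix (Fin n) (Fin p) ℝ) {lam : ℝ} (hlam : 0 < lam)
    (v : Fin n → ℝ) :
    X *ᵥ (Xᵀ *ᵥ (gramResolvent X lam *ᵥ v)) + lam • (gramResolvent X lam *ᵥ v) = v := by
  have h : (X * Xᵀ + lam • (1 : Matrix (Fin n) (Fin n) ℝ)) *ᵥ (gramResolvent X lam *ᵥ v) = v := by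
    rw [gramResolvent, Matrix.mulVec_mulVec, Matrix.mul_nonsing_inv _ (isUnit_det_gram X hlam),
      Matrix.one_mulVec]
  rwa [Matrix.add_mulVec, Matrix.smul_mulVec, Matrix.one_mulVec, ← Matrix.mulVec_mulVec] at h

/-- The normal equations give (XXᵀ + λ)(y − Xβ̂) = λy, which trades the p × p inverse for the n × n
resolvent. -/
theorem sub_mulVec_ridge (X : Matrix (Fin n) (Fin p) ℝ) (y : Fin n → ℝ) {lam : ℝ}
    (hlam : 0 < lam) : y - X *ᵥ ridge X y lam = lam • (gramResolvent X lam *ᵥ y) := by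
  have hpd : (Xᵀ * X + lam • (1 : Matrix (Fin p) (Fin p) ℝ)).PosDef := by
    refine Matrix.PosDef.posSemidef_add ?_ ?_
    · simpa using Matrix.posSemidef_conjTranspose_mul_self X
    · exact Matrix.PosDef.one.smul hlam
  set c := ridge X y lam with hc
  have h1 : (Xᵀ * X + lam • (1 : Matrix (Fin p) (Fin p) ℝ)) *ᵥ c = Xᵀ *ᵥ y := by
    rw [hc, ridge, Matrix.mulVec_mulVec,
      Matrix.mul_nonsing_inv _ ((Matrix.isUnit_iff_isUnit_det _).1 hpd.isUnit), Matrix.one_mulVec]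
  have hnorm : Xᵀ *ᵥ (X *ᵥ c) + lam • c = Xᵀ *ᵥ y := by
    rw [← h1, Matrix.add_mulVec, Matrix.smul_mulVec, Matrix.one_mulVec, Matrix.mulVec_mulVec]
  have h2 : (X * Xᵀ + lam • (1 : Matrix (Fin n) (Fin n) ℝ)) *ᵥ (y - X *ᵥ c) = lam • y := by
    have h3 : X *ᵥ (Xᵀ *ᵥ y) = X *ᵥ (Xᵀ *ᵥ (X *ᵥ c)) + lam • (X *ᵥ c) := by
      rw [← hnorm, Matrix.mulVec_add, Matrix.mulVec_smul]
    rw [Matrix.add_mulVec, Matrix.smul_mulVec, Matrix.one_mulVec, ← Matrix.mulVec_mulVec,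
      Matrix.mulVec_sub, Matrix.mulVec_sub, h3]
    module
  rw [← Matrix.mulVec_smul, ← h2, gramResolvent, Matrix.mulVec_mulVec,
    Matrix.nonsing_inv_mul _ (isUnit_det_gram X hlam), Matrix.one_mulVec]

theorem dotProduct_gramResolvent_mulVec (X : Matrix (Fin n) (Fin p) ℝ) {lam : ℝ}
    (v w : Fin n → ℝ) : gramResolvent X lam *ᵥ v ⬝ᵥ w = v ⬝ᵥ gramResolvent X lam *ᵥ w := by
  rw [Matrix.dotProduct_mulVec, ← Matrix.mulVec_transpose, gramResolvent_transpose]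

/-- Pairing XXᵀw + λw = v with w = Rv gives λ‖w‖² ≤ w·v; then expand ‖v − λw‖² ≥ 0. -/
theorem gramResolvent_mulVec_sq_le (X : Matrix (Fin n) (Fin p) ℝ) {lam : ℝ} (hlam : 0 < lam)
    (v : Fin n → ℝ) :
    lam ^ 2 * (gramResolvent X lam *ᵥ v ⬝ᵥ gramResolvent X lam *ᵥ v) ≤ v ⬝ᵥ v := by
  set w := gramResolvent X lam *ᵥ v with hw
  have h := gram_mulVec_gramResolvent_mulVec X hlam v
  rw [← hw] at h
  have h1 : w ⬝ᵥ (X *ᵥ (Xᵀ *ᵥ w)) + lam * (w ⬝ᵥ w) = w ⬝ᵥ v := by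
    conv_rhs => rw [← h]
    rw [dotProduct_add, dotProduct_smul, smul_eq_mul]
  rw [Matrix.dotProduct_mulVec, ← Matrix.mulVec_transpose] at h1
  have h2 := dotProduct_self_nonneg' (Xᵀ *ᵥ w)
  have h3 := dotProduct_self_nonneg' (v - lam • w)
  simp only [dotProduct_sub, sub_dotProduct, dotProduct_smul, smul_dotProduct, smul_eq_mul] at h3
  rw [dotProduct_comm v w] at h3
  nlinarith

/-- For w = RXu the pairing reads ‖Xᵀw‖² + λ‖w‖² = Xᵀw·u; then expand ‖u − 2Xᵀw‖² ≥ 0. The constant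
reflects x/(x + λ)² ≤ 1/(4λ), so no bound on the singular values is needed. -/
theorem gramResolvent_mulVec_mulVec_sq_le (X : Matrix (Fin n) (Fin p) ℝ) {lam : ℝ}
    (hlam : 0 < lam) (u : Fin p → ℝ) :
    4 * lam * (gramResolvent X lam *ᵥ (X *ᵥ u) ⬝ᵥ gramResolvent X lam *ᵥ (X *ᵥ u)) ≤ u ⬝ᵥ u := by
  set w := gramResolvent X lam *ᵥ (X *ᵥ u) with hw
  have h := gram_mulVec_gramResolvent_mulVec X hlam (X *ᵥ u)
  rw [← hw] at h
  have h1 : w ⬝ᵥ (X *ᵥ (Xᵀ *ᵥ w)) + lam * (w ⬝ᵥ w) = w ⬝ᵥ (X *ᵥ u) := by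
    rw [← h, dotProduct_add, dotProduct_smul, smul_eq_mul]
  rw [Matrix.dotProduct_mulVec, ← Matrix.mulVec_transpose, Matrix.dotProduct_mulVec w X u,
    ← Matrix.mulVec_transpose] at h1
  have h3 := dotProduct_self_nonneg' (u - (2 : ℝ) • (Xᵀ *ᵥ w))
  simp only [dotProduct_sub, sub_dotProduct, dotProduct_smul, smul_dotProduct, smul_eq_mul] at h3
  rw [dotProduct_comm u (Xᵀ *ᵥ w)] at h3
  linarith

theorem dotProduct_signalMatrix_mulVec (X : Matrix (Fin n) (Fin p) ℝ) (lam : ℝ)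
    (u : Fin p → ℝ) : u ⬝ᵥ signalMatrix X lam *ᵥ u =
      gramResolvent X lam *ᵥ (X *ᵥ u) ⬝ᵥ gramResolvent X lam *ᵥ (X *ᵥ u) := by
  rw [signalMatrix, ← Matrix.mulVec_mulVec, ← Matrix.mulVec_mulVec, ← Matrix.mulVec_mulVec,
    Matrix.dotProduct_mulVec u Xᵀ, Matrix.vecMul_transpose, ← dotProduct_gramResolvent_mulVec]

theorem signalMatrix_isHermitian (X : Matrix (Fin n) (Fin p) ℝ) (lam : ℝ) :
    (signalMatrix X lam).IsHermitian := by
  rw [Matrix.IsHermitian, Matrix.conjTranspose_eq_transpose_of_trivial]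
  simp [signalMatrix, Matrix.transpose_mul, gramResolvent_transpose, Matrix.mul_assoc]

theorem gramResolvent_mul_orthogonal (X : Matrix (Fin n) (Fin p) ℝ) (lam : ℝ)
    {O : Matrix (Fin p) (Fin p) ℝ} (hO : O ∈ Matrix.orthogonalGroup (Fin p) ℝ) :
    gramResolvent (X * O) lam = gramResolvent X lam := by
  have h : O * Oᵀ = 1 := by simpa using (Matrix.mem_orthogonalGroup_iff _ _).1 hO
  rw [gramResolvent, gramResolvent, Matrix.transpose_mul, Matrix.mul_assoc X O, ← Matrix.mul_assoc O,
    h, Matrix.one_mul]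

/-- Only the outer factors of XᵀR²X see a right rotation. This equivariance is what lets the
invariance of X act on the signal vector. -/
theorem signalMatrix_mul_orthogonal (X : Matrix (Fin n) (Fin p) ℝ) (lam : ℝ)
    {O : Matrix (Fin p) (Fin p) ℝ} (hO : O ∈ Matrix.orthogonalGroup (Fin p) ℝ) :
    signalMatrix (X * O) lam = Oᵀ * signalMatrix X lam * O := by
  rw [signalMatrix, gramResolvent_mul_orthogonal X lam hO, signalMatrix, Matrix.transpose_mul]
  simp only [Matrix.mul_assoc]

/-! ### Measurability of the matrix expressions -/

theorem measurable_gramResolvent (lam : ℝ) :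
    Measurable fun X : Matrix (Fin n) (Fin p) ℝ => gramResolvent X lam := by
  have h : Continuous fun X : Matrix (Fin n) (Fin p) ℝ =>
      X * Xᵀ + lam • (1 : Matrix (Fin n) (Fin n) ℝ) := by fun_prop
  have h1 : Measurable fun A : Matrix (Fin n) (Fin n) ℝ => A⁻¹ := by
    have h2 : Measurable fun A : Matrix (Fin n) (Fin n) ℝ => A.det :=
      (Continuous.matrix_det continuous_id).measurable
    have h3 : Measurable fun A : Matrix (Fin n) (Fin n) ℝ => A.adjugate :=
      (Continuous.matrix_adjugate continuous_id).measurable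
    simp only [Matrix.inv_def, Ring.inverse_eq_inv']
    exact measurable_pi_iff.2 fun i => measurable_pi_iff.2 fun j =>
      h2.inv.mul ((measurable_pi_apply j).comp ((measurable_pi_apply i).comp h3))
  exact h1.comp h.measurable

theorem measurable_matrix_mul {α : Type*} [MeasurableSpace α] {k l m : ℕ}
    {f : α → Matrix (Fin k) (Fin l) ℝ} {g : α → Matrix (Fin l) (Fin m) ℝ} (hf : Measurable f)
    (hg : Measurable g) : Measurable fun a => f a * g a :=
  measurable_pi_iff.2 fun i => measurable_pi_iff.2 fun j =>
    Finset.measurable_sum Finset.univ fun q _ => ((measurable_pi_apply q).comp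
      ((measurable_pi_apply i).comp hf)).mul ((measurable_pi_apply j).comp
        ((measurable_pi_apply q).comp hg))

theorem measurable_matrix_mulVec {α : Type*} [MeasurableSpace α] {k l : ℕ}
    {f : α → Matrix (Fin k) (Fin l) ℝ} {g : α → Fin l → ℝ} (hf : Measurable f)
    (hg : Measurable g) : Measurable fun a => f a *ᵥ g a :=
  measurable_pi_iff.2 fun i =>
    Finset.measurable_sum Finset.univ fun q _ => ((measurable_pi_apply q).comp
      ((measurable_pi_apply i).comp hf)).mul ((measurable_pi_apply q).comp hg)

theorem measurable_dotProduct {α : Type*} [MeasurableSpace α] {k : ℕ}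
    {f g : α → Fin k → ℝ} (hf : Measurable f) (hg : Measurable g) :
    Measurable fun a => f a ⬝ᵥ g a :=
  Finset.measurable_sum _ fun q _ =>
    ((measurable_pi_apply q).comp hf).mul ((measurable_pi_apply q).comp hg)

theorem measurable_matrix_trace {α : Type*} [MeasurableSpace α] {k : ℕ}
    {f : α → Matrix (Fin k) (Fin k) ℝ} (hf : Measurable f) : Measurable fun a => (f a).trace :=
  Finset.measurable_sum _ fun q _ =>
    (measurable_pi_apply q).comp ((measurable_pi_apply q).comp hf)

theorem measurable_signalMatrix (lam : ℝ) :
    Measurable fun X : Matrix (Fin n) (Fin p) ℝ => signalMatrix X lam := by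
  have h : Measurable fun X : Matrix (Fin n) (Fin p) ℝ => Xᵀ :=
    measurable_pi_iff.2 fun i => measurable_pi_iff.2 fun j =>
      (measurable_pi_apply i).comp (measurable_pi_apply j)
  exact measurable_matrix_mul (measurable_matrix_mul h
    (measurable_matrix_mul (measurable_gramResolvent lam) (measurable_gramResolvent lam)))
    measurable_id

/-! ### Diagonalization and traces -/

theorem companionEigenvalue_nonneg (X : Matrix (Fin n) (Fin p) ℝ) (i : Fin n) :
    0 ≤ companionEigenvalue X i := by
  have h : (X * Xᵀ).PosSemidef := by simpa using Matrix.posSemidef_self_mul_conjTranspose X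
  exact h.eigenvalues_nonneg i

theorem exists_diagonalization (X : Matrix (Fin n) (Fin p) ℝ) {lam : ℝ} (hlam : 0 < lam) :
    ∃ U : Matrix (Fin n) (Fin n) ℝ, star U * U = 1 ∧
      X * Xᵀ = U * Matrix.diagonal (companionEigenvalue X) * star U ∧
      gramResolvent X lam =
        U * Matrix.diagonal (fun i => (companionEigenvalue X i + lam)⁻¹) * star U := by
  have hs := (isHermitian_mul_transpose X).spectral_theorem
  set U : Matrix (Fin n) (Fin n) ℝ :=
    ((isHermitian_mul_transpose X).eigenvectorUnitary : Matrix (Fin n) (Fin n) ℝ) with hU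
  have h1 : star U * U = 1 := by simp [hU]
  have h2 : U * star U = 1 := by simp [hU]
  have hX : X * Xᵀ = U * Matrix.diagonal (companionEigenvalue X) *
      star U := by
    rw [hs, Unitary.conjStarAlgAut_apply]
    rfl
  refine ⟨U, h1, hX, ?_⟩
  rw [gramResolvent]
  refine Matrix.inv_eq_left_inv ?_
  have h3 : X * Xᵀ + lam • (1 : Matrix (Fin n) (Fin n) ℝ) =
      U * Matrix.diagonal (fun i => companionEigenvalue X i + lam) *
        star U := by
    rw [← Matrix.diagonal_add, Matrix.mul_add, Matrix.add_mul, ← hX, ← Matrix.smul_one_eq_diagonal,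
      Matrix.mul_smul, Matrix.smul_mul, Matrix.mul_one, h2]
  rw [h3]
  calc _ = U * Matrix.diagonal (fun i => (companionEigenvalue X i + lam)⁻¹) *
        (star U * U) *
        Matrix.diagonal (fun i => companionEigenvalue X i + lam) *
        star U := by simp only [Matrix.mul_assoc]
    _ = 1 := by
      rw [h1, Matrix.mul_one, Matrix.mul_assoc U (Matrix.diagonal _) (Matrix.diagonal _), Matrix.diagonal_mul_diagonal]
      have : (fun i => (companionEigenvalue X i + lam)⁻¹ * (companionEigenvalue X i + lam)) =
          fun _ => 1 := by
        funext i
        have := companionEigenvalue_nonneg X i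
        exact inv_mul_cancel₀ (by positivity)
      rw [this, Matrix.diagonal_one, Matrix.mul_one, h2]

theorem trace_gramResolvent_sq (X : Matrix (Fin n) (Fin p) ℝ) {lam : ℝ} (hlam : 0 < lam) :
    (gramResolvent X lam * gramResolvent X lam).trace =
      ∑ i, ((companionEigenvalue X i + lam) ^ 2)⁻¹ := by
  obtain ⟨U, h1, -, h3⟩ := exists_diagonalization X hlam
  have : gramResolvent X lam * gramResolvent X lam =
      U * Matrix.diagonal (fun i => ((companionEigenvalue X i + lam) ^ 2)⁻¹) * star U := by
    rw [h3]
    calc _ = U * Matrix.diagonal (fun i => (companionEigenvalue X i + lam)⁻¹) * (star U * U) *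
          Matrix.diagonal (fun i => (companionEigenvalue X i + lam)⁻¹) * star U := by
            simp only [Matrix.mul_assoc]
      _ = _ := by
        rw [h1, Matrix.mul_one, Matrix.mul_assoc U (Matrix.diagonal _) (Matrix.diagonal _),
          Matrix.diagonal_mul_diagonal]
        simp only [← mul_inv, sq]
  rw [this, Matrix.trace_mul_comm, ← Matrix.mul_assoc, h1, Matrix.one_mul, Matrix.trace_diagonal]

theorem trace_signalMatrix (X : Matrix (Fin n) (Fin p) ℝ) {lam : ℝ} (hlam : 0 < lam) :
    (signalMatrix X lam).trace =
      ∑ i, companionEigenvalue X i * ((companionEigenvalue X i + lam) ^ 2)⁻¹ := by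
  obtain ⟨U, h1, h2, h3⟩ := exists_diagonalization X hlam
  have : X * Xᵀ * (gramResolvent X lam * gramResolvent X lam) =
      U * Matrix.diagonal (fun i => companionEigenvalue X i *
        ((companionEigenvalue X i + lam) ^ 2)⁻¹) * star U := by
    rw [h3, h2]
    calc _ = U * Matrix.diagonal (companionEigenvalue X) * (star U * U) *
          Matrix.diagonal (fun i => (companionEigenvalue X i + lam)⁻¹) * (star U * U) *
          Matrix.diagonal (fun i => (companionEigenvalue X i + lam)⁻¹) * star U := by
            simp only [Matrix.mul_assoc]
      _ = _ := by
        rw [h1, Matrix.mul_one, Matrix.mul_one, Matrix.mul_assoc U (Matrix.diagonal _) (Matrix.diagonal _),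
          Matrix.diagonal_mul_diagonal, Matrix.mul_assoc U (Matrix.diagonal _) (Matrix.diagonal _),
          Matrix.diagonal_mul_diagonal]
        simp only [sq, mul_inv, mul_assoc]
  rw [signalMatrix, Matrix.trace_mul_comm, ← Matrix.mul_assoc, this, Matrix.trace_mul_comm,
    ← Matrix.mul_assoc, h1, Matrix.one_mul, Matrix.trace_diagonal]

/-! ### The coefficients of the estimating equations -/

theorem companionStieltjes_eq_sum (X : Matrix (Fin n) (Fin p) ℝ) (z : ℝ) :
    companionStieltjes X z = (n : ℝ)⁻¹ * ∑ i, (companionEigenvalue X i - z)⁻¹ := by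
  rw [companionStieltjes, stieltjes, companionSpectralMeasure, integral_smul_measure,
    integral_finsetSum_measure fun i _ => integrable_dirac (by simp)]
  simp

theorem deriv_companionStieltjes (X : Matrix (Fin n) (Fin p) ℝ) {lam : ℝ} (hlam : 0 < lam) :
    deriv (companionStieltjes X) (-lam) =
      (n : ℝ)⁻¹ * ∑ i, ((companionEigenvalue X i + lam) ^ 2)⁻¹ := by
  have h : companionStieltjes X = fun z => (n : ℝ)⁻¹ * ∑ i, (companionEigenvalue X i - z)⁻¹ :=
    funext (companionStieltjes_eq_sum X)
  rw [h]
  refine HasDerivAt.deriv (HasDerivAt.const_mul _ (HasDerivAt.fun_sum fun i _ => ?_))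
  have h0 := companionEigenvalue_nonneg X i
  have h1 : companionEigenvalue X i - -lam ≠ 0 := by
    rw [sub_neg_eq_add]
    positivity
  have h2 := ((hasDerivAt_id (-lam)).const_sub (companionEigenvalue X i)).fun_inv h1
  simpa [sub_neg_eq_add] using h2

theorem coefB_eq (X : Matrix (Fin n) (Fin p) ℝ) {lam : ℝ} (hlam : 0 < lam) :
    coefB X lam = lam ^ 2 * ((n : ℝ)⁻¹ * ∑ i, ((companionEigenvalue X i + lam) ^ 2)⁻¹) := by
  rw [coefB, deriv_companionStieltjes X hlam]

/-- From 1/(d + λ) − λ/(d + λ)² = d/(d + λ)², the bracket defining a is the normalized trace of the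
signal matrix. -/
theorem coefA_eq (X : Matrix (Fin n) (Fin p) ℝ) {lam : ℝ} (hlam : 0 < lam) :
    coefA X lam = lam ^ 2 * (((p : ℝ) / n)⁻¹ * ((n : ℝ)⁻¹ *
      ∑ i, companionEigenvalue X i * ((companionEigenvalue X i + lam) ^ 2)⁻¹)) := by
  rw [coefA, deriv_companionStieltjes X hlam, companionStieltjes_eq_sum, div_eq_mul_inv, mul_assoc]
  congr 2
  rw [mul_left_comm, ← mul_sub, Finset.mul_sum, ← Finset.sum_sub_distrib]
  congr 1
  refine Finset.sum_congr rfl fun i _ => ?_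
  have h0 := companionEigenvalue_nonneg X i
  rw [sub_neg_eq_add]
  field_simp
  ring

theorem variance_companionSpectralMeasure (X : Matrix (Fin n) (Fin p) ℝ) (hn : 0 < n) :
    Var[id; companionSpectralMeasure X] = (n : ℝ)⁻¹ * ∑ i, companionEigenvalue X i ^ 2 -
      ((n : ℝ)⁻¹ * ∑ i, companionEigenvalue X i) ^ 2 := by
  have hint : ∀ f : ℝ → ℝ, ∫ x, f x ∂(companionSpectralMeasure X) =
      (n : ℝ)⁻¹ * ∑ i, f (companionEigenvalue X i) := by
    intro f
    rw [companionSpectralMeasure, integral_smul_measure,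
      integral_finsetSum_measure fun i _ => integrable_dirac (by simp)]
    simp
  have hn' : (n : ℝ≥0∞) ≠ 0 := by exact_mod_cast hn.ne'
  have hprob : IsProbabilityMeasure (companionSpectralMeasure X) := by
    refine ⟨?_⟩
    simp [companionSpectralMeasure, ENNReal.inv_mul_cancel hn' (ENNReal.natCast_ne_top n)]
  have hmem : MemLp id 2 (companionSpectralMeasure X) := by
    refine (memLp_two_iff_integrable_sq aestronglyMeasurable_id).2 ?_
    refine Integrable.smul_measure ?_ (ENNReal.inv_ne_top.2 hn')
    exact integrable_finsetSum_measure.2 fun i _ => integrable_dirac (by simp)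
  rw [variance_eq_sub hmem, hint, hint]
  simp

end LinearAlgebra

/-! ### Gaussian averages of quadratic forms -/

theorem integral_exp_mul_sq_gaussianReal {y : ℝ} (hy : y < 1 / 2) :
    ∫ x, Real.exp (y * x ^ 2) ∂(gaussianReal 0 1) = (√(1 - 2 * y))⁻¹ := by
  rw [integral_gaussianReal_eq_integral_smul (by norm_num)]
  have h : ∀ x : ℝ, gaussianPDFReal 0 1 x • Real.exp (y * x ^ 2) =
      (√(2 * Real.pi))⁻¹ * Real.exp (-(1 / 2 - y) * x ^ 2) := by
    intro x
    rw [gaussianPDFReal, smul_eq_mul, NNReal.coe_one, mul_one, mul_assoc, ← Real.exp_add]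
    congr 2
    ring
  simp_rw [h]
  rw [integral_const_mul, integral_gaussian, ← Real.sqrt_inv, ← Real.sqrt_mul (by positivity),
    ← Real.sqrt_inv]
  congr 1
  have h1 : (1 : ℝ) - 2 * y ≠ 0 := by linarith
  have h2 : (1 : ℝ) / 2 - y ≠ 0 := by linarith
  have := Real.pi_ne_zero
  field_simp

/-- Controls the chi-square moment generating function. The linear term is kept exact, so that a
negative mean of the weights survives in the Chernoff bound. -/
theorem inv_sqrt_one_sub_le_exp {y : ℝ} (hy : |y| ≤ 1 / 4) :
    (√(1 - 2 * y))⁻¹ ≤ Real.exp (y + 2 * y ^ 2) := by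
  obtain ⟨h1, h2⟩ := abs_le.1 hy
  have hpos : 0 < 1 - 2 * y := by linarith
  have h3 : Real.exp (-(2 * y + 4 * y ^ 2)) ≤ 1 - 2 * y := by
    have key : (1 - 2 * y)⁻¹ ≤ Real.exp (2 * y + 4 * y ^ 2) := by
      rw [inv_le_iff_one_le_mul₀ hpos]
      -- Here (1 + 2y + 4y²)(1 − 2y) = 1 − 8y³. The linear bound on exp therefore suffices for y ≤
      -- 0, while y ≥ 0 needs the quadratic one.
      rcases le_total 0 y with hy0 | hy0
      · have h4 := Real.quadratic_le_exp_of_nonneg (by positivity : 0 ≤ 2 * y + 4 * y ^ 2)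
        refine le_trans ?_ (mul_le_mul_of_nonneg_right h4 hpos.le)
        have h5 : 0 ≤ y ^ 2 * (1 / 4 - y) := mul_nonneg (sq_nonneg y) (by linarith)
        have h6 : 0 ≤ y ^ 3 * (1 / 4 - y) := mul_nonneg (pow_nonneg hy0 3) (by linarith)
        have h7 : 0 ≤ y ^ 4 * (1 / 4 - y) := mul_nonneg (pow_nonneg hy0 4) (by linarith)
        have h8 := pow_nonneg hy0 3
        have h9 := pow_nonneg hy0 4
        ring_nf
        nlinarith
      · have h4 : 1 + (2 * y + 4 * y ^ 2) ≤ Real.exp (2 * y + 4 * y ^ 2) := by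
          linarith [Real.add_one_le_exp (2 * y + 4 * y ^ 2)]
        refine le_trans ?_ (mul_le_mul_of_nonneg_right h4 hpos.le)
        have h5 : 0 ≤ -y ^ 3 := by
          have := pow_nonneg (neg_nonneg.2 hy0) 3
          nlinarith
        linarith
    rw [Real.exp_neg]
    exact inv_le_of_inv_le₀ hpos key
  have h6 : Real.exp (-(y + 2 * y ^ 2)) ≤ √(1 - 2 * y) := by
    refine Real.le_sqrt_of_sq_le ?_
    rw [← Real.exp_nat_mul]
    refine le_trans (le_of_eq ?_) h3
    push_cast
    ring_nf
  calc (√(1 - 2 * y))⁻¹ ≤ (Real.exp (-(y + 2 * y ^ 2)))⁻¹ :=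
        inv_anti₀ (Real.exp_pos _) h6
    _ = _ := by rw [← Real.exp_neg, neg_neg]

/-- Chernoff bound: with tilt θ, the logarithm of the moment generating function is at most p(−θs +
2θ²K²). -/
theorem pi_gaussianReal_sum_sq_pos_le {p : ℕ} (c : Fin p → ℝ) {K s : ℝ} (hs : 0 < s)
    (hsK : s ≤ K) (hc : ∀ i, |c i| ≤ K) (hsum : ∑ i, c i ≤ -(p * s)) :
    (Measure.pi fun _ : Fin p => gaussianReal 0 1) {g | 0 < ∑ i, c i * g i ^ 2} ≤
      ENNReal.ofReal (Real.exp (-(s ^ 2 / (8 * K ^ 2)) * p)) := by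
  have hK : 0 < K := hs.trans_le hsK
  -- This θ minimizes −θs + 2θ²K², with value −s²/(8K²), and s ≤ K keeps θ|c i| ≤ 1/4.
  set θ : ℝ := s / (4 * K ^ 2) with hθ
  have hθ0 : 0 < θ := by positivity
  have hθK : θ * K ≤ 1 / 4 := by
    rw [hθ, div_mul_eq_mul_div, div_le_div_iff₀ (by positivity) (by norm_num)]
    nlinarith
  have hθc : ∀ i, |θ * c i| ≤ 1 / 4 := by
    intro i
    rw [abs_mul, abs_of_pos hθ0]
    exact (mul_le_mul_of_nonneg_left (hc i) hθ0.le).trans hθK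
  set G : Measure (Fin p → ℝ) := Measure.pi fun _ : Fin p => gaussianReal 0 1
  set f : (Fin p → ℝ) → ℝ := fun g => ∏ i, Real.exp (θ * c i * g i ^ 2) with hf
  have hint : ∫ g, f g ∂G = ∏ i, (√(1 - 2 * (θ * c i)))⁻¹ := by
    rw [hf, integral_fintype_prod_eq_prod (f := fun i x => Real.exp (θ * c i * x ^ 2))]
    refine Finset.prod_congr rfl fun i _ => integral_exp_mul_sq_gaussianReal ?_
    linarith [(abs_le.1 (hθc i)).2]
  have hpos : 0 < ∫ g, f g ∂G := by
    rw [hint]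
    refine Finset.prod_pos fun i _ => inv_pos.2 (Real.sqrt_pos.2 ?_)
    linarith [(abs_le.1 (hθc i)).2]
  -- The product formula assumes no integrability; a nonzero Bochner integral then forces it.
  have hfi : Integrable f G := by
    by_contra h
    rw [integral_undef h] at hpos
    exact hpos.false
  have hle : ∫ g, f g ∂G ≤ Real.exp (-(s ^ 2 / (8 * K ^ 2)) * p) := by
    rw [hint]
    calc ∏ i, (√(1 - 2 * (θ * c i)))⁻¹
        ≤ ∏ i, Real.exp (θ * c i + 2 * (θ * c i) ^ 2) :=
          Finset.prod_le_prod (fun i _ => by positivity) fun i _ => inv_sqrt_one_sub_le_exp (hθc i)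
      _ = Real.exp (∑ i, (θ * c i + 2 * (θ * c i) ^ 2)) := (Real.exp_sum _ _).symm
      _ ≤ _ := by
        refine Real.exp_le_exp.2 ?_
        have h1 : ∑ i, 2 * (θ * c i) ^ 2 ≤ ∑ _i : Fin p, 2 * θ ^ 2 * K ^ 2 := by
          refine Finset.sum_le_sum fun i _ => ?_
          have : c i ^ 2 ≤ K ^ 2 := sq_le_sq' (abs_le.1 (hc i)).1 (abs_le.1 (hc i)).2
          nlinarith [mul_le_mul_of_nonneg_left this (sq_nonneg θ)]
        rw [Finset.sum_const, Finset.card_univ, Fintype.card_fin, nsmul_eq_mul] at h1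
        rw [Finset.sum_add_distrib, ← Finset.mul_sum]
        have h2 := mul_le_mul_of_nonneg_left hsum hθ0.le
        have h3 : θ * -(p * s) + p * (2 * θ ^ 2 * K ^ 2) = -(s ^ 2 / (8 * K ^ 2)) * p := by
          rw [hθ]
          field_simp
          ring
        linarith
  have hsub : {g : Fin p → ℝ | 0 < ∑ i, c i * g i ^ 2} ⊆ {g | 1 ≤ f g} := by
    intro g hg
    simp only [Set.mem_ofPred_eq] at hg ⊢
    change 1 ≤ ∏ i, Real.exp (θ * c i * g i ^ 2)
    rw [← Real.exp_sum]
    refine Real.one_le_exp ?_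
    simp only [mul_assoc]
    rw [← Finset.mul_sum]
    exact mul_nonneg hθ0.le hg.le
  have hmarkov := mul_meas_ge_le_integral_of_nonneg
    (ae_of_all G fun g => Finset.prod_nonneg fun i _ => (Real.exp_pos (θ * c i * g i ^ 2)).le)
    hfi 1
  rw [one_mul] at hmarkov
  calc G {g | 0 < ∑ i, c i * g i ^ 2} ≤ G {g | 1 ≤ f g} := measure_mono hsub
    _ = ENNReal.ofReal (G.real {g | 1 ≤ f g}) := by
      rw [ofReal_measureReal]
    _ ≤ _ := ENNReal.ofReal_le_ofReal (hmarkov.trans hle)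

/-- In an eigenbasis of A the event becomes ∑ c i * g i ^ 2 > 0, where c i is an eigenvalue minus tr
A / p minus s. These weights sum to −ps and are bounded by 2K + s. Stating the event homogeneously
in g avoids dividing by ‖g‖². -/
theorem stdGaussian_quadraticForm_le {p : ℕ} {A : Matrix (Fin p) (Fin p) ℝ} (hA : A.IsHermitian)
    {K s : ℝ} (hK : 0 ≤ K) (hs : 0 < s) (hAK : ∀ u : Fin p → ℝ, |u ⬝ᵥ A *ᵥ u| ≤ K * (u ⬝ᵥ u)) :
    stdGaussian (EuclideanSpace ℝ (Fin p))
        {g | s * (g.ofLp ⬝ᵥ g.ofLp) < g.ofLp ⬝ᵥ A *ᵥ g.ofLp - A.trace / p * (g.ofLp ⬝ᵥ g.ofLp)} ≤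
      ENNReal.ofReal (Real.exp (-(s ^ 2 / (8 * (2 * K + s) ^ 2)) * p)) := by
  set b := hA.eigenvectorBasis
  have horth : ∀ i j, (b i).ofLp ⬝ᵥ (b j).ofLp = if i = j then 1 else 0 := by
    intro i j
    have := orthonormal_iff_ite.1 b.orthonormal j i
    rw [EuclideanSpace.inner_eq_star_dotProduct] at this
    simpa [eq_comm] using this
  have hm : ∀ i, |hA.eigenvalues i| ≤ K := by
    intro i
    have h := hAK (b i).ofLp
    rw [hA.mulVec_eigenvectorBasis, dotProduct_smul, horth] at h
    simpa using h
  have htr : |A.trace| ≤ p * K := by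
    rw [hA.trace_eq_sum_eigenvalues]
    refine (Finset.abs_sum_le_sum_abs _ _).trans ((Finset.sum_le_sum fun i _ => hm i).trans ?_)
    simp
  set c : Fin p → ℝ := fun i => hA.eigenvalues i - A.trace / p - s with hc
  have hset : (fun x : Fin p → ℝ => ∑ i, x i • b i) ⁻¹'
      {g | s * (g.ofLp ⬝ᵥ g.ofLp) < g.ofLp ⬝ᵥ A *ᵥ g.ofLp - A.trace / p * (g.ofLp ⬝ᵥ g.ofLp)} =
      {g | 0 < ∑ i, c i * g i ^ 2} := by
    ext x
    have h1 : (∑ i, x i • b i).ofLp = ∑ i, x i • (b i).ofLp := by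
      simp [WithLp.ofLp_sum]
    have h2 : (∑ i, x i • (b i).ofLp) ⬝ᵥ (∑ i, x i • (b i).ofLp) = ∑ i, x i ^ 2 := by
      simp only [sum_dotProduct, dotProduct_sum, smul_dotProduct, dotProduct_smul, horth,
        smul_eq_mul]
      simp [sq]
    have h3 : (∑ i, x i • (b i).ofLp) ⬝ᵥ A *ᵥ (∑ i, x i • (b i).ofLp) =
        ∑ i, hA.eigenvalues i * x i ^ 2 := by
      rw [Matrix.mulVec_sum]
      simp only [Matrix.mulVec_smul, b, hA.mulVec_eigenvectorBasis]
      simp only [sum_dotProduct, dotProduct_sum, smul_dotProduct, dotProduct_smul, smul_eq_mul]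
      simp only [show ∀ i j, (hA.eigenvectorBasis i).ofLp ⬝ᵥ (hA.eigenvectorBasis j).ofLp =
        if i = j then 1 else 0 from horth]
      refine Finset.sum_congr rfl fun i _ => ?_
      simp
      ring
    rw [Set.mem_preimage, Set.mem_ofPred_eq, Set.mem_ofPred_eq, h1, h2, h3, ← sub_pos]
    simp only [hc, sub_mul, Finset.sum_sub_distrib, ← Finset.mul_sum]
  rw [stdGaussian_eq_map_pi_orthonormalBasis b, Measure.map_apply (by fun_prop) ?_, hset]
  · rcases Nat.eq_zero_or_pos p with rfl | hp
    · simp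
    have hp' : (0 : ℝ) < p := by exact_mod_cast hp
    have htr' : |A.trace / p| ≤ K := by
      rw [abs_div, abs_of_pos hp', div_le_iff₀ hp', mul_comm]
      exact htr
    refine pi_gaussianReal_sum_sq_pos_le c hs (by linarith) (fun i => ?_) ?_
    · have := hm i
      rw [abs_le] at this htr' ⊢
      simp only [hc]
      constructor <;> linarith
    · simp only [hc, Finset.sum_sub_distrib]
      have h4 : ∑ i, hA.eigenvalues i = A.trace := by
        rw [hA.trace_eq_sum_eigenvalues]
        simp
      simp only [h4, Finset.sum_const, Finset.card_univ, Fintype.card_fin, nsmul_eq_mul]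
      rw [mul_div_cancel₀ _ hp'.ne']
      linarith
  · refine measurableSet_lt ?_ ?_ <;> refine Continuous.measurable ?_ <;> fun_prop

/-! ### Rotations acting on a random matrix -/

/-- Householder reflection along w = u − v: equal norms give 2 w·u = w·w, so u is sent to u − w = v.
-/
theorem exists_orthogonal_mulVec_eq {p : ℕ} {u v : Fin p → ℝ} (h : u ⬝ᵥ u = v ⬝ᵥ v) :
    ∃ O ∈ Matrix.orthogonalGroup (Fin p) ℝ, O *ᵥ u = v := by
  by_cases huv : u = v
  · exact ⟨1, one_mem _, by rw [huv, Matrix.one_mulVec]⟩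
  set w := u - v with hw
  have hww : w ⬝ᵥ w ≠ 0 := by
    rw [Ne, dotProduct_self_eq_zero, hw, sub_eq_zero]
    exact huv
  have hwu : 2 * (w ⬝ᵥ u) = w ⬝ᵥ w := by
    simp only [hw, sub_dotProduct, dotProduct_sub, dotProduct_comm v u]
    linarith
  set c := 2 / (w ⬝ᵥ w) with hc
  have hcw : c * (w ⬝ᵥ w) = 2 := by rw [hc]; field_simp
  refine ⟨1 - c • Matrix.vecMulVec w w, ?_, ?_⟩
  · rw [Matrix.mem_orthogonalGroup_iff]
    have ht : (1 - c • Matrix.vecMulVec w w)ᵀ = 1 - c • Matrix.vecMulVec w w := by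
      simp [Matrix.transpose_vecMulVec]
    rw [ht, Matrix.sub_mul, Matrix.one_mul, Matrix.mul_sub, Matrix.mul_one, Matrix.smul_mul, Matrix.mul_smul, Matrix.vecMulVec_mul_vecMulVec,
      Matrix.vecMulVec_smul, smul_smul, smul_smul]
    have : c * c * (w ⬝ᵥ w) = 2 * c := by rw [mul_assoc, hcw, mul_comm]
    rw [this]
    module
  · rw [Matrix.sub_mulVec, Matrix.one_mulVec, Matrix.smul_mulVec, Matrix.vecMulVec_mulVec]
    have : c * (w ⬝ᵥ u) = 1 := by linear_combination (1 / 2 : ℝ) * hcw + c / 2 * hwu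
    simp only [op_smul_eq_smul, smul_smul, this, one_smul]
    rw [hw]
    abel

/-- A quadratic form that rotates with a right-rotationally invariant matrix concentrates at its
normalized trace, at any fixed vector. -/
theorem measure_quadraticForm_le_of_invariant {n p : ℕ} {ν : Measure (Matrix (Fin n) (Fin p) ℝ)}
    [IsProbabilityMeasure ν]
    (hν : ∀ O ∈ Matrix.orthogonalGroup (Fin p) ℝ, ν.map (fun x => x * O) = ν)
    {F : Matrix (Fin n) (Fin p) ℝ → Matrix (Fin p) (Fin p) ℝ} (hF : Measurable F)
    (hFO : ∀ x, ∀ O ∈ Matrix.orthogonalGroup (Fin p) ℝ, F (x * O) = Oᵀ * F x * O)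
    (hFH : ∀ x, (F x).IsHermitian) {K s : ℝ} (hK : 0 ≤ K) (hs : 0 < s)
    (hFK : ∀ x, ∀ u : Fin p → ℝ, |u ⬝ᵥ F x *ᵥ u| ≤ K * (u ⬝ᵥ u)) (b : Fin p → ℝ) :
    ν {x | s * (b ⬝ᵥ b) < b ⬝ᵥ F x *ᵥ b - (F x).trace / p * (b ⬝ᵥ b)} ≤
      ENNReal.ofReal (Real.exp (-(s ^ 2 / (8 * (2 * K + s) ^ 2)) * p)) := by
  set S : (Fin p → ℝ) → Set (Matrix (Fin n) (Fin p) ℝ) := fun b =>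
    {x | s * (b ⬝ᵥ b) < b ⬝ᵥ F x *ᵥ b - (F x).trace / p * (b ⬝ᵥ b)} with hS
  have hjoint : MeasurableSet {z : Matrix (Fin n) (Fin p) ℝ × EuclideanSpace ℝ (Fin p) |
      s * (z.2.ofLp ⬝ᵥ z.2.ofLp) < z.2.ofLp ⬝ᵥ F z.1 *ᵥ z.2.ofLp -
        (F z.1).trace / p * (z.2.ofLp ⬝ᵥ z.2.ofLp)} := by
    have h2 : Measurable fun z : Matrix (Fin n) (Fin p) ℝ × EuclideanSpace ℝ (Fin p) =>
      z.2.ofLp := by fun_prop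
    have h1 : Measurable fun z : Matrix (Fin n) (Fin p) ℝ × EuclideanSpace ℝ (Fin p) => F z.1 :=
      hF.comp measurable_fst
    exact measurableSet_lt ((measurable_dotProduct h2 h2).const_mul _)
      ((measurable_dotProduct h2 (measurable_matrix_mulVec h1 h2)).sub
        (((measurable_matrix_trace h1).div_const _).mul (measurable_dotProduct h2 h2)))
  have hSm : ∀ b, MeasurableSet (S b) := by
    intro b
    exact measurable_prodMk_right (y := WithLp.toLp 2 b) hjoint
  -- Invariance of ν moves the rotation from x to the vector. Together with `hscale`, ν (S u) is the
  -- same for all u ≠ 0.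
  have hrot : ∀ u v : Fin p → ℝ, u ⬝ᵥ u = v ⬝ᵥ v → ν (S u) = ν (S v) := by
    intro u v huv
    obtain ⟨O, hO, rfl⟩ := exists_orthogonal_mulVec_eq huv
    have h1 : O * Oᵀ = 1 := by simpa using (Matrix.mem_orthogonalGroup_iff _ _).1 hO
    have hm : Measurable fun x : Matrix (Fin n) (Fin p) ℝ => x * O :=
      measurable_matrix_mul measurable_id measurable_const
    conv_lhs => rw [← hν O hO]
    rw [Measure.map_apply hm (hSm u)]
    congr 1
    ext x
    simp only [hS, Set.mem_preimage, Set.mem_ofPred_eq]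
    rw [hFO x O hO, Matrix.trace_mul_comm, ← Matrix.mul_assoc, h1, Matrix.one_mul,
      ← Matrix.mulVec_mulVec, ← Matrix.mulVec_mulVec, Matrix.dotProduct_mulVec u Oᵀ,
      Matrix.vecMul_transpose, huv]
  have hscale : ∀ (t : ℝ) (u : Fin p → ℝ), t ≠ 0 → S (t • u) = S u := by
    intro t u ht
    ext x
    simp only [hS, Set.mem_ofPred_eq, Matrix.mulVec_smul, dotProduct_smul, smul_dotProduct,
      smul_eq_mul]
    have ht2 : 0 < t * t := mul_self_pos.2 ht
    rw [← mul_lt_mul_iff_right₀ ht2 (b := s * (u ⬝ᵥ u))]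
    ring_nf
  by_cases hb : b = 0
  · subst hb
    simp
  have hbb : 0 < b ⬝ᵥ b := by
    refine lt_of_le_of_ne (dotProduct_self_nonneg' b) (Ne.symm ?_)
    rwa [Ne, dotProduct_self_eq_zero]
  have hall : ∀ g : Fin p → ℝ, g ≠ 0 → ν (S g) = ν (S b) := by
    intro g hg
    have hgg : 0 < g ⬝ᵥ g := by
      refine lt_of_le_of_ne (dotProduct_self_nonneg' g) (Ne.symm ?_)
      rwa [Ne, dotProduct_self_eq_zero]
    have hq : 0 < (b ⬝ᵥ b) / (g ⬝ᵥ g) := by positivity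
    rw [← hscale (√((b ⬝ᵥ b) / (g ⬝ᵥ g))) g (Real.sqrt_pos.2 hq).ne']
    refine hrot _ _ ?_
    rw [smul_dotProduct, dotProduct_smul, smul_eq_mul, smul_eq_mul, ← mul_assoc,
      Real.mul_self_sqrt hq.le]
    field_simp
  set G := stdGaussian (EuclideanSpace ℝ (Fin p)) with hG
  set T : Set (Matrix (Fin n) (Fin p) ℝ × EuclideanSpace ℝ (Fin p)) :=
    {z | s * (z.2.ofLp ⬝ᵥ z.2.ofLp) < z.2.ofLp ⬝ᵥ F z.1 *ᵥ z.2.ofLp -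
        (F z.1).trace / p * (z.2.ofLp ⬝ᵥ z.2.ofLp)} with hT
  have hGbound : ∀ x, G (Prod.mk x ⁻¹' T) ≤
      ENNReal.ofReal (Real.exp (-(s ^ 2 / (8 * (2 * K + s) ^ 2)) * p)) := fun x =>
    stdGaussian_quadraticForm_le (hFH x) hK hs (hFK x)
  have hG0 : ∀ᵐ g ∂G, g ≠ 0 := by
    have hp : Nonempty (Fin p) := by
      by_contra h
      rw [not_nonempty_iff] at h
      exact hb (Subsingleton.elim _ _)
    obtain ⟨i⟩ := hp
    have : NullSingletonClass (gaussianReal 0 1) :=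
      nullSingletonClass_gaussianReal (by norm_num)
    have hna := Measure.pi_nullSingletonClass (μ := fun _ : Fin p => gaussianReal 0 1) i
    rw [hG, ← map_pi_eq_stdGaussian]
    refine (ae_map_iff (p := fun g : EuclideanSpace ℝ (Fin p) => g ≠ 0)
      (f := WithLp.toLp 2) (by fun_prop) (measurableSet_singleton 0).compl).2 ?_
    have h0 : ∀ᵐ g ∂(Measure.pi fun _ : Fin p => gaussianReal 0 1), g ≠ 0 := by
      rw [ae_iff]
      simp
    filter_upwards [h0] with g hg
    simpa using hg
  -- Fubini in both orders: freezing g gives ν (S b) for almost every g, while freezing x gives the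
  -- Gaussian bound.
  have h1 : (ν.prod G) T = ν (S b) := by
    rw [Measure.prod_apply_symm hjoint]
    have : ∀ᵐ g ∂G, ν ((fun x => (x, g)) ⁻¹' T) = ν (S b) := by
      filter_upwards [hG0] with g hg
      refine hall g.ofLp ?_
      simpa using hg
    rw [lintegral_congr_ae this]
    simp
  change ν (S b) ≤ _
  rw [← h1, Measure.prod_apply hjoint]
  refine (lintegral_mono hGbound).trans ?_
  simp

/-! ### Fourth moments of sums and of quadratic forms in independent variables -/

section Moments

variable {Ω : Type*} [MeasurableSpace Ω] {P : Measure Ω}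

theorem integrable_mul_of_integrable_pow_four {S T : Ω → ℝ} (hS : Measurable S)
    (hT : Measurable T) (hS4 : Integrable (fun ω => S ω ^ 4) P)
    (hT4 : Integrable (fun ω => T ω ^ 4) P) {i j : ℕ} (hij : i + j = 4) :
    Integrable (fun ω => S ω ^ i * T ω ^ j) P := by
  refine (hS4.add hT4).mono' ((hS.pow_const i).mul (hT.pow_const j)).aestronglyMeasurable
    (ae_of_all _ fun ω => ?_)
  rw [Real.norm_eq_abs, abs_mul, abs_pow, abs_pow, Pi.add_apply]
  have h1 : S ω ^ 4 = |S ω| ^ 4 := by rw [Even.pow_abs (by decide)]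
  have h2 : T ω ^ 4 = |T ω| ^ 4 := by rw [Even.pow_abs (by decide)]
  rw [h1, h2]
  have hs := abs_nonneg (S ω)
  have ht := abs_nonneg (T ω)
  rcases le_total |S ω| |T ω| with h | h
  · calc |S ω| ^ i * |T ω| ^ j ≤ |T ω| ^ i * |T ω| ^ j := by gcongr
      _ = |T ω| ^ 4 := by rw [← pow_add, hij]
      _ ≤ _ := le_add_of_nonneg_left (by positivity)
  · calc |S ω| ^ i * |T ω| ^ j ≤ |S ω| ^ i * |S ω| ^ j := by gcongr
      _ = |S ω| ^ 4 := by rw [← pow_add, hij]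
      _ ≤ _ := le_add_of_nonneg_right (by positivity)

theorem indepFun_of_notMem {n : ℕ} {β : Type*} [MeasurableSpace β]
    {ξ : Fin n → Ω → ℝ} (hind : iIndepFun ξ P) (hm : ∀ i, Measurable (ξ i)) {s : Finset (Fin n)}
    {k : Fin n} (hk : k ∉ s) {g : (s → ℝ) → β} (hg : Measurable g) :
    IndepFun (fun ω => g fun i => ξ i ω) (ξ k) P := by
  have h := hind.indepFun_finset s {k} (Finset.disjoint_singleton_right.2 hk) hm
  exact h.comp (ψ := fun x : ({k} : Finset (Fin n)) → ℝ => x ⟨k, Finset.mem_singleton_self k⟩)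
    hg (measurable_pi_apply _)

variable [IsProbabilityMeasure P]

theorem integrable_pow_of_integrable_pow_four {ξ : Ω → ℝ} (hm : Measurable ξ)
    (h4 : Integrable (fun ω => ξ ω ^ 4) P) {k : ℕ} (hk : k ≤ 4) :
    Integrable (fun ω => ξ ω ^ k) P := by
  refine ((integrable_const (1 : ℝ)).add h4).mono' (hm.pow_const k).aestronglyMeasurable
    (ae_of_all _ fun ω => ?_)
  rw [Real.norm_eq_abs, abs_pow, Pi.add_apply]
  have h : ξ ω ^ 4 = |ξ ω| ^ 4 := by rw [Even.pow_abs (by decide)]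
  rw [h]
  rcases le_total |ξ ω| 1 with h1 | h1
  · have := pow_le_one₀ (abs_nonneg _) h1 (n := k)
    have : 0 ≤ |ξ ω| ^ 4 := by positivity
    linarith
  · have := pow_le_pow_right₀ h1 hk
    linarith

/-- Expansion of `E (S + ξ T)⁴` for a centred `ξ` independent of `(S, T)`. -/
theorem integral_add_mul_pow_four {S T ξ : Ω → ℝ} (hS : Measurable S) (hT : Measurable T)
    (hξ : Measurable ξ) (hind : IndepFun (fun ω => (S ω, T ω)) ξ P)
    (hS4 : Integrable (fun ω => S ω ^ 4) P) (hT4 : Integrable (fun ω => T ω ^ 4) P)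
    (hξ4 : Integrable (fun ω => ξ ω ^ 4) P) (h0 : ∫ ω, ξ ω ∂P = 0) :
    Integrable (fun ω => (S ω + ξ ω * T ω) ^ 4) P ∧
      ∫ ω, (S ω + ξ ω * T ω) ^ 4 ∂P = ∫ ω, S ω ^ 4 ∂P +
        6 * (∫ ω, ξ ω ^ 2 ∂P) * (∫ ω, S ω ^ 2 * T ω ^ 2 ∂P) +
        4 * (∫ ω, ξ ω ^ 3 ∂P) * (∫ ω, S ω * T ω ^ 3 ∂P) +
        (∫ ω, ξ ω ^ 4 ∂P) * (∫ ω, T ω ^ 4 ∂P) := by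
  have hi : ∀ i j k : ℕ, i + j = 4 → k ≤ 4 →
      Integrable (fun ω => S ω ^ i * T ω ^ j * ξ ω ^ k) P ∧
      ∫ ω, S ω ^ i * T ω ^ j * ξ ω ^ k ∂P =
        (∫ ω, S ω ^ i * T ω ^ j ∂P) * ∫ ω, ξ ω ^ k ∂P := by
    intro i j k hij hk
    have hI : IndepFun (fun ω => S ω ^ i * T ω ^ j) (fun ω => ξ ω ^ k) P :=
      hind.comp (φ := fun z : ℝ × ℝ => z.1 ^ i * z.2 ^ j) (ψ := fun x : ℝ => x ^ k)
        (by fun_prop) (by fun_prop)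
    have h1 := integrable_mul_of_integrable_pow_four hS hT hS4 hT4 hij
    have h2 := integrable_pow_of_integrable_pow_four hξ hξ4 hk
    exact ⟨hI.integrable_mul h1 h2,
      hI.integral_fun_mul_eq_mul_integral h1.aestronglyMeasurable h2.aestronglyMeasurable⟩
  obtain ⟨i1, e1⟩ := hi 3 1 1 (by norm_num) (by norm_num)
  obtain ⟨i2, e2⟩ := hi 2 2 2 (by norm_num) (by norm_num)
  obtain ⟨i3, e3⟩ := hi 1 3 3 (by norm_num) (by norm_num)
  obtain ⟨i4, e4⟩ := hi 0 4 4 (by norm_num) (by norm_num)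
  simp only [pow_one, pow_zero, one_mul, h0, mul_zero] at i1 e1 i2 e2 i3 e3 i4 e4
  have hexp : (fun ω => (S ω + ξ ω * T ω) ^ 4) = fun ω => S ω ^ 4 +
      4 * (S ω ^ 3 * T ω * ξ ω) + 6 * (S ω ^ 2 * T ω ^ 2 * ξ ω ^ 2) +
      4 * (S ω * T ω ^ 3 * ξ ω ^ 3) + T ω ^ 4 * ξ ω ^ 4 := by
    funext ω
    ring
  have j1 := i1.const_mul 4
  have j2 := i2.const_mul 6
  have j3 := i3.const_mul 4
  refine ⟨by rw [hexp]; exact (((hS4.add j1).add j2).add j3).add i4, ?_⟩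
  have k1 : Integrable (fun ω => S ω ^ 4 + 4 * (S ω ^ 3 * T ω * ξ ω)) P := hS4.add j1
  have k2 : Integrable (fun ω => S ω ^ 4 + 4 * (S ω ^ 3 * T ω * ξ ω) +
      6 * (S ω ^ 2 * T ω ^ 2 * ξ ω ^ 2)) P := k1.add j2
  have k3 : Integrable (fun ω => S ω ^ 4 + 4 * (S ω ^ 3 * T ω * ξ ω) +
      6 * (S ω ^ 2 * T ω ^ 2 * ξ ω ^ 2) + 4 * (S ω * T ω ^ 3 * ξ ω ^ 3)) P := k2.add j3
  rw [hexp, integral_add k3 i4, integral_add k2 j3, integral_add k1 j2, integral_add hS4 j1,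
    integral_const_mul, integral_const_mul, integral_const_mul, e1, e2, e3, e4]
  ring

/-- Induction adding one variable, with T = 1 in `integral_add_mul_pow_four`. The mixed term 6 E S²
E ξ² is the cross term of 3(V + v)², so the second moment bound is carried along. -/
theorem integral_sum_pow_four_le {n : ℕ} {ξ : Fin n → Ω → ℝ} (hind : iIndepFun ξ P)
    (hm : ∀ i, Measurable (ξ i)) (h4 : ∀ i, Integrable (fun ω => ξ i ω ^ 4) P)
    (h0 : ∀ i, ∫ ω, ξ i ω ∂P = 0) {v f : Fin n → ℝ} (hv : ∀ i, ∫ ω, ξ i ω ^ 2 ∂P ≤ v i)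
    (hf : ∀ i, ∫ ω, ξ i ω ^ 4 ∂P ≤ f i) (s : Finset (Fin n)) :
    Integrable (fun ω => (∑ i ∈ s, ξ i ω) ^ 4) P ∧
      ∫ ω, (∑ i ∈ s, ξ i ω) ^ 4 ∂P ≤ ∑ i ∈ s, f i + 3 * (∑ i ∈ s, v i) ^ 2 ∧
      ∫ ω, (∑ i ∈ s, ξ i ω) ^ 2 ∂P ≤ ∑ i ∈ s, v i := by
  induction s using Finset.induction_on with
  | empty => simp
  | insert k s hk ih =>
    obtain ⟨ih4, ihle, ih2⟩ := ih
    have hv0 : ∀ i, 0 ≤ v i := fun i => (integral_nonneg fun ω => sq_nonneg _).trans (hv i)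
    have hSm : Measurable fun ω => ∑ i ∈ s, ξ i ω := Finset.measurable_sum _ fun i _ => hm i
    have hI : IndepFun (fun ω => (∑ i ∈ s, ξ i ω, (1 : ℝ))) (ξ k) P := by
      have := indepFun_of_notMem hind hm hk
        (g := fun x : s → ℝ => (∑ i, x i, (1 : ℝ))) (by fun_prop)
      convert this using 2 with ω
      exact congrArg (fun z => (z, (1 : ℝ))) (Finset.sum_coe_sort s fun i => ξ i ω).symm
    obtain ⟨j4, e4⟩ := integral_add_mul_pow_four hSm measurable_const (hm k) hI ih4
      (by simp) (h4 k) (h0 k)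
    simp only [one_pow, mul_one] at j4 e4
    have hS1 := integrable_pow_of_integrable_pow_four hSm ih4 (show 1 ≤ 4 by norm_num)
    have hS2 := integrable_pow_of_integrable_pow_four hSm ih4 (show 2 ≤ 4 by norm_num)
    have hξ1 := integrable_pow_of_integrable_pow_four (hm k) (h4 k) (show 1 ≤ 4 by norm_num)
    have hξ2 := integrable_pow_of_integrable_pow_four (hm k) (h4 k) (show 2 ≤ 4 by norm_num)
    simp only [pow_one] at hS1 hξ1
    have hS0 : ∫ ω, ∑ i ∈ s, ξ i ω ∂P = 0 := by
      rw [integral_finsetSum]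
      · exact Finset.sum_eq_zero fun i _ => h0 i
      · intro i _
        simpa using integrable_pow_of_integrable_pow_four (hm i) (h4 i) (show 1 ≤ 4 by norm_num)
    have hI1 : IndepFun (fun ω => ∑ i ∈ s, ξ i ω) (ξ k) P :=
      hI.comp (φ := Prod.fst) (ψ := id) measurable_fst measurable_id
    have e2 : ∫ ω, (∑ i ∈ s, ξ i ω + ξ k ω) ^ 2 ∂P =
        ∫ ω, (∑ i ∈ s, ξ i ω) ^ 2 ∂P + ∫ ω, ξ k ω ^ 2 ∂P := by
      have hexp : (fun ω => (∑ i ∈ s, ξ i ω + ξ k ω) ^ 2) = fun ω => (∑ i ∈ s, ξ i ω) ^ 2 +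
          2 * ((∑ i ∈ s, ξ i ω) * ξ k ω) + ξ k ω ^ 2 := by
        funext ω
        ring
      have hmul := hI1.integrable_mul hS1 hξ1
      have hmul' : Integrable (fun ω => 2 * ((∑ i ∈ s, ξ i ω) * ξ k ω)) P := hmul.const_mul 2
      have hadd : Integrable (fun ω => (∑ i ∈ s, ξ i ω) ^ 2 +
          2 * ((∑ i ∈ s, ξ i ω) * ξ k ω)) P := hS2.add hmul'
      rw [hexp, integral_add hadd hξ2, integral_add hS2 hmul', integral_const_mul,
        hI1.integral_fun_mul_eq_mul_integral hS1.aestronglyMeasurable hξ1.aestronglyMeasurable,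
        hS0]
      ring
    simp only [Finset.sum_insert hk, add_comm (ξ k _)]
    refine ⟨j4, ?_, ?_⟩
    · rw [e4, hS0]
      have h5 : (∫ ω, ξ k ω ^ 2 ∂P) * ∫ ω, (∑ i ∈ s, ξ i ω) ^ 2 ∂P ≤ v k * ∑ i ∈ s, v i :=
        mul_le_mul (hv k) ih2 (integral_nonneg fun ω => sq_nonneg _) (hv0 k)
      simp only [integral_const, probReal_univ, smul_eq_mul, mul_one, mul_zero, add_zero]
      nlinarith [hf k, sq_nonneg (v k)]
    · rw [e2]
      linarith [hv k]

theorem integral_linear_pow_four_le {n : ℕ} {ξ : Fin n → Ω → ℝ} (hind : iIndepFun ξ P)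
    (hm : ∀ i, Measurable (ξ i)) (h4 : ∀ i, Integrable (fun ω => ξ i ω ^ 4) P)
    (h0 : ∀ i, ∫ ω, ξ i ω ∂P = 0) {m : ℝ} (hm1 : 1 ≤ m) (hv : ∀ i, ∫ ω, ξ i ω ^ 2 ∂P ≤ m)
    (hf : ∀ i, ∫ ω, ξ i ω ^ 4 ∂P ≤ m) {a : Fin n → ℝ} {κ : ℝ} {s : Finset (Fin n)}
    (ha : ∑ i ∈ s, a i ^ 2 ≤ κ) :
    Integrable (fun ω => (∑ i ∈ s, a i * ξ i ω) ^ 4) P ∧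
      ∫ ω, (∑ i ∈ s, a i * ξ i ω) ^ 4 ∂P ≤ 4 * κ ^ 2 * m ^ 2 := by
  obtain ⟨h1, h2, -⟩ := integral_sum_pow_four_le (ξ := fun i ω => a i * ξ i ω)
    (v := fun i => a i ^ 2 * m) (f := fun i => a i ^ 4 * m)
    (hind.comp (fun i x => a i * x) fun i => measurable_const.mul measurable_id)
    (fun i => (hm i).const_mul _)
    (fun i => by simpa only [mul_pow] using (h4 i).const_mul (a i ^ 4))
    (fun i => by rw [integral_const_mul, h0, mul_zero])
    (fun i => by
      simp only [mul_pow]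
      rw [integral_const_mul]
      exact mul_le_mul_of_nonneg_left (hv i) (sq_nonneg _))
    (fun i => by
      simp only [mul_pow]
      rw [integral_const_mul]
      exact mul_le_mul_of_nonneg_left (hf i) (by positivity)) s
  refine ⟨h1, h2.trans ?_⟩
  rw [← Finset.sum_mul, ← Finset.sum_mul]
  have h3 : ∑ i ∈ s, a i ^ 4 ≤ (∑ i ∈ s, a i ^ 2) ^ 2 := by
    have := Finset.sum_sq_le_sq_sum_of_nonneg (s := s) (f := fun i => a i ^ 2)
      fun i _ => sq_nonneg _
    simpa only [← pow_mul] using this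
  have hs0 : 0 ≤ ∑ i ∈ s, a i ^ 2 := Finset.sum_nonneg fun i _ => sq_nonneg _
  have h4' : (∑ i ∈ s, a i ^ 2) ^ 2 ≤ κ ^ 2 := by gcongr
  have h5 : m ≤ m ^ 2 := by nlinarith
  calc (∑ i ∈ s, a i ^ 4) * m + 3 * ((∑ i ∈ s, a i ^ 2) * m) ^ 2
      ≤ κ ^ 2 * m ^ 2 + 3 * (κ ^ 2 * m ^ 2) := by
        rw [mul_pow]
        gcongr
        exact h3.trans h4'
    _ = _ := by ring

/-- A new index k changes the form S into S + ξ_k T, with T linear and (S, T) independent of ξ_k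
because the diagonal of B vanishes. The fourth moment of T is bounded, so each step should cost a
multiple of the cardinality, whence the quadratic growth. -/
theorem integral_offDiagonal_pow_four_le {n : ℕ} {ξ : Fin n → Ω → ℝ} (hind : iIndepFun ξ P)
    (hm : ∀ i, Measurable (ξ i)) (h4 : ∀ i, Integrable (fun ω => ξ i ω ^ 4) P)
    (h0 : ∀ i, ∫ ω, ξ i ω ∂P = 0) {m : ℝ} (hm1 : 1 ≤ m) (hv : ∀ i, ∫ ω, ξ i ω ^ 2 ∂P ≤ m)
    (hf : ∀ i, ∫ ω, ξ i ω ^ 4 ∂P ≤ m) {B : Matrix (Fin n) (Fin n) ℝ}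
    (hB : ∀ i j, B i j = B j i) (hB0 : ∀ i, B i i = 0) {κ : ℝ}
    (hBκ : ∀ i, ∑ j, B i j ^ 2 ≤ κ) (s : Finset (Fin n)) :
    Integrable (fun ω => (∑ i ∈ s, ∑ j ∈ s, B i j * ξ i ω * ξ j ω) ^ 4) P ∧
      ∫ ω, (∑ i ∈ s, ∑ j ∈ s, B i j * ξ i ω * ξ j ω) ^ 4 ∂P ≤
        1216 * κ ^ 2 * m ^ 4 * (s.card : ℝ) ^ 2 := by
  induction s using Finset.induction_on with
  | empty => simp
  | insert k s hk ih =>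
    obtain ⟨ih4, ihle⟩ := ih
    set S : Ω → ℝ := fun ω => ∑ i ∈ s, ∑ j ∈ s, B i j * ξ i ω * ξ j ω with hS
    set T : Ω → ℝ := fun ω => ∑ j ∈ s, 2 * B k j * ξ j ω with hT
    have hSm : Measurable S := Finset.measurable_sum _ fun i _ =>
      Finset.measurable_sum _ fun j _ => ((hm i).const_mul _).mul (hm j)
    have hTm : Measurable T := Finset.measurable_sum _ fun j _ => (hm j).const_mul _
    have hrow : ∑ j ∈ s, (2 * B k j) ^ 2 ≤ 4 * κ := by
      have h1 : ∑ j ∈ s, B k j ^ 2 ≤ κ := (Finset.sum_le_sum_of_subset_of_nonneg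
        (Finset.subset_univ s) fun _ _ _ => sq_nonneg _).trans (hBκ k)
      calc ∑ j ∈ s, (2 * B k j) ^ 2 = 4 * ∑ j ∈ s, B k j ^ 2 := by
            rw [Finset.mul_sum]
            exact Finset.sum_congr rfl fun j _ => by ring
        _ ≤ _ := by linarith
    obtain ⟨hT4, hTle⟩ := integral_linear_pow_four_le hind hm h4 h0 hm1 hv hf hrow
    have hI : IndepFun (fun ω => (S ω, T ω)) (ξ k) P := by
      have := indepFun_of_notMem hind hm hk
        (g := fun x : s → ℝ => (∑ i : s, ∑ j : s, B i j * x i * x j, ∑ j : s, 2 * B k j * x j))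
        (by fun_prop)
      convert this using 2 with ω
      refine Prod.ext ?_ ?_
      · simp only [hS]
        rw [← Finset.sum_coe_sort s fun i => ∑ j ∈ s, B i j * ξ i ω * ξ j ω]
        exact Finset.sum_congr rfl fun i _ =>
          (Finset.sum_coe_sort s fun j => B i j * ξ i ω * ξ j ω).symm
      · exact (Finset.sum_coe_sort s fun j => 2 * B k j * ξ j ω).symm
    obtain ⟨j4, e4⟩ := integral_add_mul_pow_four hSm hTm (hm k) hI ih4 hT4 (h4 k) (h0 k)
    have hsum : (fun ω => (∑ i ∈ insert k s, ∑ j ∈ insert k s, B i j * ξ i ω * ξ j ω) ^ 4) =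
        fun ω => (S ω + ξ k ω * T ω) ^ 4 := by
      funext ω
      congr 1
      simp only [Finset.sum_insert hk, hB0, Finset.sum_add_distrib, hS, hT, Finset.mul_sum]
      have : ∑ i ∈ s, B i k * ξ i ω * ξ k ω = ∑ i ∈ s, B k i * ξ k ω * ξ i ω :=
        Finset.sum_congr rfl fun i _ => by rw [hB i k]; ring
      have h2 : ∑ i ∈ s, ξ k ω * (2 * B k i * ξ i ω) = 2 * ∑ i ∈ s, B k i * ξ k ω * ξ i ω := by
        rw [Finset.mul_sum]
        exact Finset.sum_congr rfl fun i _ => by ring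
      rw [this, h2]
      ring
    rw [hsum]
    refine ⟨j4, ?_⟩
    rw [e4, Finset.card_insert_of_notMem hk, Nat.cast_add, Nat.cast_one]
    set c : ℝ := (s.card : ℝ) with hc
    have hc0 : 0 ≤ c := Nat.cast_nonneg _
    have iST := integrable_mul_of_integrable_pow_four hSm hTm ih4 hT4 (show 2 + 2 = 4 by norm_num)
    have iST3 := integrable_mul_of_integrable_pow_four hSm hTm ih4 hT4
      (show 1 + 3 = 4 by norm_num)
    have h3 : |∫ ω, ξ k ω ^ 3 ∂P| ≤ m := by
      have i3 := integrable_pow_of_integrable_pow_four (hm k) (h4 k) (show 3 ≤ 4 by norm_num)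
      refine (abs_integral_le_integral_abs).trans ?_
      calc ∫ ω, |ξ k ω ^ 3| ∂P ≤ ∫ ω, (1 / 4 + 3 / 4 * ξ k ω ^ 4) ∂P := by
            refine integral_mono i3.abs ((integrable_const _).add ((h4 k).const_mul _)) fun ω => ?_
            have h : ξ k ω ^ 4 = |ξ k ω| ^ 4 := by rw [Even.pow_abs (by decide)]
            simp only [abs_pow]
            rw [h]
            nlinarith [sq_nonneg (|ξ k ω| - 1), sq_nonneg (|ξ k ω| ^ 2 - 1),
              sq_nonneg (|ξ k ω| ^ 2 - |ξ k ω|), abs_nonneg (ξ k ω)]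
        _ = 1 / 4 + 3 / 4 * ∫ ω, ξ k ω ^ 4 ∂P := by
            rw [integral_add (integrable_const _) ((h4 k).const_mul _), integral_const_mul]
            simp
        _ ≤ m := by linarith [hf k]
    have hST3 : |∫ ω, S ω * T ω ^ 3 ∂P| ≤
        1 / 2 * (∫ ω, S ω ^ 2 * T ω ^ 2 ∂P) + 1 / 2 * ∫ ω, T ω ^ 4 ∂P := by
      simp only [pow_one] at iST3
      refine (abs_integral_le_integral_abs).trans ?_
      rw [← integral_const_mul, ← integral_const_mul,
        ← integral_add (iST.const_mul _) (hT4.const_mul _)]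
      refine integral_mono iST3.abs ((iST.const_mul _).add (hT4.const_mul _)) fun ω => ?_
      simp only
      rw [abs_le]
      constructor <;> nlinarith [sq_nonneg (T ω * (S ω - T ω)), sq_nonneg (T ω * (S ω + T ω))]
    -- Young's inequality with weight c + 1: the share of E S⁴ is 1/(c + 1), which the induction
    -- hypothesis Hc² turns into at most Hc. As (c + 1)² = c² + c + (c + 1), this leaves H(c + 1)
    -- for the terms in E T⁴. The factor 8 is 6 from the second-moment term plus 2 from the
    -- third-moment term.
    have hST : 8 * m * ∫ ω, S ω ^ 2 * T ω ^ 2 ∂P ≤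
        (∫ ω, S ω ^ 4 ∂P) / (c + 1) + 16 * m ^ 2 * (c + 1) * ∫ ω, T ω ^ 4 ∂P := by
      rw [← integral_const_mul, ← integral_const_mul, ← integral_div,
        ← integral_add (ih4.div_const _) (hT4.const_mul _)]
      refine integral_mono (iST.const_mul _) ((ih4.div_const _).add (hT4.const_mul _)) fun ω => ?_
      simp only
      have hc1 : 0 < c + 1 := by linarith
      have h5 : S ω ^ 4 / (c + 1) + 16 * m ^ 2 * (c + 1) * T ω ^ 4 -
          8 * m * (S ω ^ 2 * T ω ^ 2) =
          (S ω ^ 2 - 4 * m * (c + 1) * T ω ^ 2) ^ 2 / (c + 1) := by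
        field_simp
        ring
      have h6 : 0 ≤ (S ω ^ 2 - 4 * m * (c + 1) * T ω ^ 2) ^ 2 / (c + 1) := by positivity
      linarith
    set s4 := ∫ ω, S ω ^ 4 ∂P
    set t4 := ∫ ω, T ω ^ 4 ∂P
    set st := ∫ ω, S ω ^ 2 * T ω ^ 2 ∂P
    have hst0 : 0 ≤ st := integral_nonneg fun ω => by positivity
    have ht0 : 0 ≤ t4 := integral_nonneg fun ω => by positivity
    have hm0 : 0 ≤ m := by linarith
    have hterm1 : 6 * (∫ ω, ξ k ω ^ 2 ∂P) * st ≤ 6 * m * st := by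
      gcongr
      exact hv k
    have hterm2 : 4 * (∫ ω, ξ k ω ^ 3 ∂P) * (∫ ω, S ω * T ω ^ 3 ∂P) ≤
        4 * m * (1 / 2 * st + 1 / 2 * t4) := by
      refine (le_abs_self _).trans ?_
      rw [abs_mul, abs_mul, abs_of_nonneg (by norm_num : (0 : ℝ) ≤ 4)]
      gcongr
    have hterm3 : (∫ ω, ξ k ω ^ 4 ∂P) * t4 ≤ m * t4 := by
      gcongr
      exact hf k
    have hH : 0 ≤ 1216 * κ ^ 2 * m ^ 4 := by positivity
    have hs4 : s4 / (c + 1) ≤ 1216 * κ ^ 2 * m ^ 4 * c := by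
      rw [div_le_iff₀ (by linarith)]
      nlinarith [mul_nonneg hH hc0]
    have ht4 : t4 ≤ 64 * κ ^ 2 * m ^ 2 := by
      refine hTle.trans (le_of_eq ?_)
      ring
    have hmm : m ≤ m ^ 2 := by nlinarith
    -- The constant is 1216 = (16 + 3) · 64, where 64 comes from the row bound 4κ on the
    -- coefficients of T.
    have h7 : 16 * m ^ 2 * (c + 1) * t4 + 3 * m * t4 ≤ 1216 * κ ^ 2 * m ^ 4 * (c + 1) := by
      have h8 : 3 * m ≤ 3 * m ^ 2 * (c + 1) := by nlinarith [sq_nonneg m]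
      calc 16 * m ^ 2 * (c + 1) * t4 + 3 * m * t4
          ≤ 16 * m ^ 2 * (c + 1) * t4 + 3 * m ^ 2 * (c + 1) * t4 := by gcongr
        _ = 19 * m ^ 2 * (c + 1) * t4 := by ring
        _ ≤ 19 * m ^ 2 * (c + 1) * (64 * κ ^ 2 * m ^ 2) := by gcongr
        _ = _ := by ring
    have h9 : 1216 * κ ^ 2 * m ^ 4 * (c + 1) ^ 2 = 1216 * κ ^ 2 * m ^ 4 * c ^ 2 +
        1216 * κ ^ 2 * m ^ 4 * c + 1216 * κ ^ 2 * m ^ 4 * (c + 1) := by ring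
    rw [h9]
    linarith

end Moments

/-! ### Tail bounds for the noise -/

section NoiseTail

variable {Ω : Type*} [MeasurableSpace Ω] {P : Measure Ω} [IsProbabilityMeasure P] {n : ℕ}

theorem measure_abs_ge_le_of_pow_four {S : Ω → ℝ} (hS : Integrable (fun ω => S ω ^ 4) P) {c a : ℝ}
    (hc : ∫ ω, S ω ^ 4 ∂P ≤ c) (ha : 0 < a) :
    P {ω | a ≤ |S ω|} ≤ ENNReal.ofReal (c / a ^ 4) := by
  have h := mul_meas_ge_le_integral_of_nonneg (μ := P) (f := fun ω => S ω ^ 4)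
    (ae_of_all _ fun ω => by positivity) hS (a ^ 4)
  have hset : {ω | a ≤ |S ω|} ⊆ {ω | a ^ 4 ≤ S ω ^ 4} := by
    intro ω hω
    simp only [Set.mem_ofPred_eq] at hω ⊢
    calc a ^ 4 ≤ |S ω| ^ 4 := by gcongr
      _ = S ω ^ 4 := by rw [Even.pow_abs (by decide)]
  refine (measure_mono hset).trans ?_
  rw [← ofReal_measureReal]
  refine ENNReal.ofReal_le_ofReal ?_
  rw [le_div_iff₀ (by positivity), mul_comm]
  exact h.trans hc

/-- A fourth moment of ξ² would need eight moments of ξ. After truncation a single centred term has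
fourth moment at most τ²m, while its variance stays below m whatever τ is. -/
theorem integral_truncated_sq_pow_four_le {ξ : Fin n → Ω → ℝ} (hind : iIndepFun ξ P)
    (hm : ∀ i, Measurable (ξ i)) (h4 : ∀ i, Integrable (fun ω => ξ i ω ^ 4) P) {m : ℝ}
    (hf : ∀ i, ∫ ω, ξ i ω ^ 4 ∂P ≤ m) {τ κ : ℝ} (hτ : 0 < τ) {a : Fin n → ℝ}
    (ha : ∀ i, a i ^ 2 ≤ κ) :
    Integrable (fun ω => (∑ i, a i * (min (ξ i ω ^ 2) τ - ∫ ω, min (ξ i ω ^ 2) τ ∂P)) ^ 4) P ∧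
      ∫ ω, (∑ i, a i * (min (ξ i ω ^ 2) τ - ∫ ω, min (ξ i ω ^ 2) τ ∂P)) ^ 4 ∂P ≤
        n * (κ ^ 2 * τ ^ 2 * m) + 3 * (n * (κ * m)) ^ 2 := by
  set e : Fin n → ℝ := fun i => ∫ ω, min (ξ i ω ^ 2) τ ∂P with he
  have hzm : ∀ i, Measurable fun ω => min (ξ i ω ^ 2) τ := fun i =>
    ((hm i).pow_const 2).min measurable_const
  have hz0 : ∀ i ω, 0 ≤ min (ξ i ω ^ 2) τ := fun i ω => le_min (sq_nonneg _) hτ.le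
  have hzτ : ∀ i ω, min (ξ i ω ^ 2) τ ≤ τ := fun i ω => min_le_right _ _
  have hzi : ∀ i, MemLp (fun ω => min (ξ i ω ^ 2) τ) ∞ P := fun i =>
    memLp_top_of_bound (hzm i).aestronglyMeasurable τ
      (ae_of_all _ fun ω => by rw [Real.norm_eq_abs, abs_of_nonneg (hz0 i ω)]; exact hzτ i ω)
  have he0 : ∀ i, 0 ≤ e i := fun i => integral_nonneg (hz0 i)
  have heτ : ∀ i, e i ≤ τ := fun i => by
    refine (integral_mono ((hzi i).integrable le_top) (integrable_const τ) (hzτ i)).trans ?_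
    simp
  have hdm : ∀ i, Measurable fun ω => min (ξ i ω ^ 2) τ - e i := fun i => (hzm i).sub_const _
  have hdabs : ∀ i ω, (min (ξ i ω ^ 2) τ - e i) ^ 2 ≤ τ ^ 2 := fun i ω => by
    refine sq_le_sq' ?_ ?_ <;> linarith [hz0 i ω, hzτ i ω, he0 i, heτ i]
  have hdi : ∀ i (k : ℕ), Integrable (fun ω => (min (ξ i ω ^ 2) τ - e i) ^ k) P := by
    intro i k
    refine Integrable.of_bound ((hdm i).pow_const k).aestronglyMeasurable (τ ^ k)
      (ae_of_all _ fun ω => ?_)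
    rw [norm_pow, Real.norm_eq_abs]
    exact pow_le_pow_left₀ (abs_nonneg _) (abs_le_of_sq_le_sq (hdabs i ω) hτ.le) k
  have hvar : ∀ i, ∫ ω, (min (ξ i ω ^ 2) τ - e i) ^ 2 ∂P ≤ m := by
    intro i
    have h1 := variance_le_expectation_sq (μ := P) (hzm i).aestronglyMeasurable
    rw [variance_eq_integral (hzm i).aemeasurable] at h1
    refine h1.trans (le_trans ?_ (hf i))
    refine integral_mono (((hzi i).mono_exponent le_top).integrable_sq) (h4 i) fun ω => ?_
    simp only [Pi.pow_apply]
    calc (min (ξ i ω ^ 2) τ) ^ 2 ≤ (ξ i ω ^ 2) ^ 2 := by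
          gcongr
          exact min_le_left _ _
      _ = ξ i ω ^ 4 := by ring
  have hm0 : ∀ _ : Fin n, 0 ≤ m := fun i =>
    (integral_nonneg fun ω => by positivity).trans (hf i)
  have hind' : iIndepFun (fun i ω => a i * (min (ξ i ω ^ 2) τ - e i)) P :=
    hind.comp (fun i x => a i * (min (x ^ 2) τ - e i)) fun i => by fun_prop
  obtain ⟨h1, h2, -⟩ := integral_sum_pow_four_le
    (v := fun _ => κ * m) (f := fun _ => κ ^ 2 * τ ^ 2 * m) hind'
    (fun i => (hdm i).const_mul _)
    (fun i => by simpa only [mul_pow] using (hdi i 4).const_mul (a i ^ 4))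
    (fun i => by
      rw [integral_const_mul, integral_sub ((hzi i).integrable le_top) (integrable_const _)]
      simp [he])
    (fun i => by
      simp only [mul_pow]
      rw [integral_const_mul]
      exact mul_le_mul (ha i) (hvar i) (integral_nonneg fun ω => sq_nonneg _)
        ((sq_nonneg _).trans (ha i)))
    (fun i => by
      simp only [mul_pow]
      rw [integral_const_mul, mul_assoc]
      have hd4 : ∫ ω, (min (ξ i ω ^ 2) τ - e i) ^ 4 ∂P ≤ τ ^ 2 * m := by
        refine le_trans (integral_mono (hdi i 4) ((hdi i 2).const_mul (τ ^ 2)) fun ω => ?_) ?_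
        · simp only
          nlinarith [hdabs i ω, sq_nonneg (min (ξ i ω ^ 2) τ - e i)]
        · rw [integral_const_mul]
          exact mul_le_mul_of_nonneg_left (hvar i) (sq_nonneg _)
      refine mul_le_mul ?_ hd4 (integral_nonneg fun ω => by positivity) (sq_nonneg _)
      calc a i ^ 4 = (a i ^ 2) ^ 2 := by ring
        _ ≤ κ ^ 2 := by
          gcongr
          exact ha i) Finset.univ
  refine ⟨h1, h2.trans (le_of_eq ?_)⟩
  simp

/-- Truncation changes ξ² only where ξ² > τ, and there ξ² − τ ≤ ξ⁴/τ. -/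
theorem abs_integral_truncated_sq_sub_le {ξ : Ω → ℝ} (hm : Measurable ξ)
    (h4 : Integrable (fun ω => ξ ω ^ 4) P) {m τ : ℝ} (hf : ∫ ω, ξ ω ^ 4 ∂P ≤ m) (hτ : 0 < τ) :
    |∫ ω, min (ξ ω ^ 2) τ ∂P - ∫ ω, ξ ω ^ 2 ∂P| ≤ m / τ := by
  have h2 := integrable_pow_of_integrable_pow_four hm h4 (show 2 ≤ 4 by norm_num)
  have hz : Integrable (fun ω => min (ξ ω ^ 2) τ) P := h2.inf (integrable_const τ)
  rw [← integral_sub hz h2]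
  refine (abs_integral_le_integral_abs).trans ?_
  calc ∫ ω, |min (ξ ω ^ 2) τ - ξ ω ^ 2| ∂P ≤ ∫ ω, ξ ω ^ 4 / τ ∂P := by
        refine integral_mono (hz.sub h2).abs (h4.div_const τ) fun ω => ?_
        simp only
        rw [abs_of_nonpos (by linarith [min_le_left (ξ ω ^ 2) τ]), le_div_iff₀ hτ]
        rcases le_total (ξ ω ^ 2) τ with h | h
        · rw [min_eq_left h]
          simp
          positivity
        · rw [min_eq_right h]
          nlinarith [sq_nonneg (ξ ω), sq_nonneg (ξ ω ^ 2 - τ)]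
    _ = (∫ ω, ξ ω ^ 4 ∂P) / τ := integral_div _ _
    _ ≤ m / τ := by gcongr

/-- When no square exceeds τ, the centred form is an off-diagonal part, a truncated centred diagonal
and a deterministic bias. Fourth moments handle the first two parts, and a union bound handles the
exceptional event. -/
theorem measure_noise_quadraticForm_le {ξ : Fin n → Ω → ℝ} (hn : 0 < n) (hind : iIndepFun ξ P)
    (hm : ∀ i, Measurable (ξ i)) (h4 : ∀ i, Integrable (fun ω => ξ i ω ^ 4) P)
    (h0 : ∀ i, ∫ ω, ξ i ω ∂P = 0) {m σ : ℝ} (hm1 : 1 ≤ m) (hσm : σ ^ 2 ≤ m)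
    (hσ : ∀ i, ∫ ω, ξ i ω ^ 2 ∂P = σ ^ 2) (hf : ∀ i, ∫ ω, ξ i ω ^ 4 ∂P ≤ m)
    {A : Matrix (Fin n) (Fin n) ℝ} (hA : ∀ i j, A i j = A j i) {K : ℝ} (hK : 0 ≤ K)
    (hAK : ∀ i, ∑ j, A i j ^ 2 ≤ K ^ 2) {τ t : ℝ} (hτ : 0 < τ) (ht : 0 < t)
    (hτt : K * (m / τ) ≤ t / 4) {q : ℝ} (hq0 : 0 ≤ q)
    (hq : ∀ i, P {ω | τ < ξ i ω ^ 2} ≤ ENNReal.ofReal q) :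
    P {ω | t * n < |(fun i => ξ i ω) ⬝ᵥ A *ᵥ (fun i => ξ i ω) - σ ^ 2 * A.trace|} ≤
      ENNReal.ofReal (1216 * (K ^ 2) ^ 2 * m ^ 4 * n ^ 2 / (t / 3 * n) ^ 4 +
        (n * ((K ^ 2) ^ 2 * τ ^ 2 * m) + 3 * (n * (K ^ 2 * m)) ^ 2) / (t / 3 * n) ^ 4 + n * q) := by
  have hn' : (0 : ℝ) < n := by exact_mod_cast hn
  set B : Matrix (Fin n) (Fin n) ℝ := fun i j => if i = j then 0 else A i j with hBdef
  have hB : ∀ i j, B i j = B j i := by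
    intro i j
    simp only [hBdef, hA i j, eq_comm]
  have hB0 : ∀ i, B i i = 0 := fun i => by simp [hBdef]
  have hBK : ∀ i, ∑ j, B i j ^ 2 ≤ K ^ 2 := by
    intro i
    refine (Finset.sum_le_sum fun j _ => ?_).trans (hAK i)
    simp only [hBdef]
    split_ifs
    · simpa using sq_nonneg (A i j)
    · exact le_rfl
  have hdiag : ∀ i, A i i ^ 2 ≤ K ^ 2 := fun i =>
    (Finset.single_le_sum (f := fun j => A i j ^ 2) (fun j _ => sq_nonneg _)
      (Finset.mem_univ i)).trans (hAK i)
  have hdiag' : ∀ i, |A i i| ≤ K := fun i => abs_le_of_sq_le_sq (hdiag i) hK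
  obtain ⟨hQ4, hQ⟩ := integral_offDiagonal_pow_four_le hind hm h4 h0 hm1
    (fun i => (hσ i).le.trans hσm) hf hB hB0 hBK Finset.univ
  obtain ⟨hD4, hD⟩ := integral_truncated_sq_pow_four_le hind hm h4 hf hτ (a := fun i => A i i) hdiag
  rw [Finset.card_univ, Fintype.card_fin] at hQ
  set Q : Ω → ℝ := fun ω => ∑ i, ∑ j, B i j * ξ i ω * ξ j ω with hQdef
  set e : Fin n → ℝ := fun i => ∫ ω, min (ξ i ω ^ 2) τ ∂P with he
  set D : Ω → ℝ := fun ω => ∑ i, A i i * (min (ξ i ω ^ 2) τ - e i) with hDdef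
  have hbias : |∑ i, A i i * (e i - σ ^ 2)| ≤ t / 4 * n := by
    calc |∑ i, A i i * (e i - σ ^ 2)| ≤ ∑ i, |A i i * (e i - σ ^ 2)| :=
          Finset.abs_sum_le_sum_abs _ _
      _ ≤ ∑ _i : Fin n, K * (m / τ) := by
        refine Finset.sum_le_sum fun i _ => ?_
        rw [abs_mul]
        refine mul_le_mul (hdiag' i) ?_ (abs_nonneg _) hK
        have := abs_integral_truncated_sq_sub_le (hm i) (h4 i) (hf i) hτ
        rwa [hσ i] at this
      _ = n * (K * (m / τ)) := by simp
      _ ≤ n * (t / 4) := by gcongr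
      _ = _ := mul_comm _ _
  have hdecomp : ∀ ω, (∀ i, ξ i ω ^ 2 ≤ τ) →
      (fun i => ξ i ω) ⬝ᵥ A *ᵥ (fun i => ξ i ω) - σ ^ 2 * A.trace =
        Q ω + D ω + ∑ i, A i i * (e i - σ ^ 2) := by
    intro ω hω
    have h1 : (fun i => ξ i ω) ⬝ᵥ A *ᵥ (fun i => ξ i ω) = Q ω + ∑ i, A i i * ξ i ω ^ 2 := by
      simp only [hQdef, dotProduct, Matrix.mulVec, Finset.mul_sum]
      rw [← Finset.sum_add_distrib]
      refine Finset.sum_congr rfl fun i _ => ?_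
      have h2 : A i i * ξ i ω ^ 2 = ∑ j, if i = j then A i j * ξ i ω * ξ j ω else 0 := by
        simp
        ring
      rw [h2, ← Finset.sum_add_distrib]
      refine Finset.sum_congr rfl fun j _ => ?_
      simp only [hBdef]
      split_ifs <;> ring
    have h3 : D ω = ∑ i, A i i * (ξ i ω ^ 2 - e i) := by
      simp only [hDdef]
      exact Finset.sum_congr rfl fun i _ => by rw [min_eq_left (hω i)]
    have h5 : ∑ i, A i i * ξ i ω ^ 2 = ∑ i, A i i * (ξ i ω ^ 2 - e i) +
        ∑ i, A i i * (e i - σ ^ 2) + σ ^ 2 * A.trace := by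
      rw [Matrix.trace, Finset.mul_sum, ← Finset.sum_add_distrib, ← Finset.sum_add_distrib]
      refine Finset.sum_congr rfl fun i _ => ?_
      rw [Matrix.diag_apply]
      ring
    rw [h1, h3, h5]
    ring
  -- The three parts get the shares t/3, t/3 and t/4, whose sum is below t.
  have hsub : {ω | t * n < |(fun i => ξ i ω) ⬝ᵥ A *ᵥ (fun i => ξ i ω) - σ ^ 2 * A.trace|} ⊆
      {ω | t / 3 * n ≤ |Q ω|} ∪ {ω | t / 3 * n ≤ |D ω|} ∪ ⋃ i, {ω | τ < ξ i ω ^ 2} := by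
    intro ω hω
    by_contra hcon
    simp only [Set.mem_union, Set.mem_iUnion, Set.mem_ofPred_eq, not_or, not_le, not_exists,
      not_lt] at hcon hω
    obtain ⟨⟨c1, c2⟩, c3⟩ := hcon
    rw [hdecomp ω c3] at hω
    have h1 := abs_add_le (Q ω + D ω) (∑ i, A i i * (e i - σ ^ 2))
    have h2 := abs_add_le (Q ω) (D ω)
    have h3 : 0 < t * n := by positivity
    linarith
  have htn : 0 < t / 3 * n := by positivity
  have hU : P (⋃ i, {ω | τ < ξ i ω ^ 2}) ≤ ENNReal.ofReal (n * q) := by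
    refine (measure_iUnion_fintype_le _ _).trans ((Finset.sum_le_sum fun i _ => hq i).trans ?_)
    rw [Finset.sum_const, Finset.card_univ, Fintype.card_fin, nsmul_eq_mul,
      ENNReal.ofReal_mul (by positivity), ENNReal.ofReal_natCast]
  have hm0 : 0 ≤ m := by linarith
  rw [ENNReal.ofReal_add (by positivity) (by positivity),
    ENNReal.ofReal_add (by positivity) (by positivity)]
  refine (measure_mono hsub).trans ((measure_union_le _ _).trans (add_le_add ?_ hU))
  exact (measure_union_le _ _).trans (add_le_add
    (measure_abs_ge_le_of_pow_four hQ4 hQ htn) (measure_abs_ge_le_of_pow_four hD4 hD htn))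

end NoiseTail

/-! ### Almost sure convergence of the three parts of the training error -/

section AlmostSure

variable {Ω : Type*} [MeasurableSpace Ω] {P : Measure Ω}

/-- Borel–Cantelli at the thresholds 1/(k + 1). Only the law of each e n matters, so nothing is
required of the joint law in n. -/
theorem ae_tendsto_zero_of_summable {e : ℕ → Ω → ℝ}
    (h : ∀ t > 0, ∃ u : ℕ → ℝ, Summable u ∧
      ∀ᶠ n in atTop, P {ω | t < |e n ω|} ≤ ENNReal.ofReal (u n)) :
    ∀ᵐ ω ∂P, Tendsto (fun n => e n ω) atTop (𝓝 0) := by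
  have h1 : ∀ k : ℕ, ∀ᵐ ω ∂P, ∀ᶠ n in atTop, |e n ω| ≤ 1 / ((k : ℝ) + 1) := by
    intro k
    obtain ⟨u, hu, hle⟩ := h (1 / ((k : ℝ) + 1)) (by positivity)
    obtain ⟨N, hN⟩ := eventually_atTop.1 hle
    have hsum : ∑' n, P {ω | 1 / ((k : ℝ) + 1) < |e (n + N) ω|} ≠ ∞ := by
      have hu' : Summable fun n => u (n + N) := (summable_nat_add_iff N).2 hu
      refine ne_top_of_le_ne_top hu'.tsum_ofReal_ne_top (ENNReal.tsum_le_tsum fun n => ?_)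
      exact hN (n + N) (Nat.le_add_left N n)
    filter_upwards [ae_eventually_notMem hsum] with ω hω
    obtain ⟨N', hN'⟩ := eventually_atTop.1 hω
    refine eventually_atTop.2 ⟨N' + N, fun n hn => ?_⟩
    have := hN' (n - N) (by omega)
    rw [Nat.sub_add_cancel (by omega)] at this
    simpa using this
  filter_upwards [ae_all_iff.2 h1] with ω hω
  rw [Metric.tendsto_atTop']
  intro δ hδ
  obtain ⟨k, hk⟩ := exists_nat_one_div_lt hδ
  obtain ⟨N, hN⟩ := eventually_atTop.1 (hω k)
  exact ⟨N, fun n hn => by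
    rw [Real.dist_eq, sub_zero]
    exact (hN n hn.le).trans_lt hk⟩

theorem measure_lt_sq_le_of_lintegral_rpow_le {ξ : Ω → ℝ} (hm : Measurable ξ) {η : ℝ}
    (hη : 0 < η) {M : ℝ≥0} (hM : ∫⁻ ω, ‖ξ ω‖ₑ ^ (4 + η) ∂P ≤ M) {τ : ℝ} (hτ : 0 < τ) :
    P {ω | τ < ξ ω ^ 2} ≤ ENNReal.ofReal (M / τ ^ ((4 + η) / 2)) := by
  have hpos : 0 < τ ^ ((4 + η) / 2) := Real.rpow_pos_of_pos hτ _
  have h1 := mul_meas_ge_le_lintegral₀ (μ := P) (f := fun ω => ‖ξ ω‖ₑ ^ (4 + η))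
    (hm.enorm.pow_const _).aemeasurable (ENNReal.ofReal (τ ^ ((4 + η) / 2)))
  have hsub : {ω | τ < ξ ω ^ 2} ⊆
      {ω | ENNReal.ofReal (τ ^ ((4 + η) / 2)) ≤ ‖ξ ω‖ₑ ^ (4 + η)} := by
    intro ω hω
    simp only [Set.mem_ofPred_eq] at hω ⊢
    rw [Real.enorm_eq_ofReal_abs, ENNReal.ofReal_rpow_of_nonneg (abs_nonneg _) (by linarith)]
    refine ENNReal.ofReal_le_ofReal ?_
    have h2 : |ξ ω| ^ (4 + η) = (ξ ω ^ 2) ^ ((4 + η) / 2) := by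
      rw [← sq_abs, ← Real.rpow_natCast, ← Real.rpow_mul (abs_nonneg _)]
      congr 1
      push_cast
      ring
    rw [h2]
    exact Real.rpow_le_rpow hτ.le hω.le (by linarith)
  refine (measure_mono hsub).trans ?_
  rw [ENNReal.ofReal_div_of_pos hpos, ENNReal.le_div_iff_mul_le (Or.inl (by simpa using hpos))
    (Or.inl ENNReal.ofReal_ne_top), mul_comm, ENNReal.ofReal_coe_nnreal]
  exact h1.trans hM

theorem map_mul_orthogonal_eq {n p : ℕ} {X : Ω → Matrix (Fin n) (Fin p) ℝ}
    (hX : RightRotationallyInvariant X P) :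
    AEMeasurable X P ∧ ∀ O ∈ Matrix.orthogonalGroup (Fin p) ℝ,
      (P.map X).map (fun x => x * O) = P.map X := by
  -- `IdentDistrib` carries a.e. measurability, and O = 1 extracts it for X itself.
  have hm : AEMeasurable X P := by
    simpa using (hX 1 (one_mem _)).aemeasurable_snd
  refine ⟨hm, fun O hO => ?_⟩
  have hO' : Measurable fun x : Matrix (Fin n) (Fin p) ℝ => x * O :=
    measurable_matrix_mul measurable_id measurable_const
  rw [AEMeasurable.map_map_of_aemeasurable hO'.aemeasurable hm]
  exact (hX O hO).map_eq

variable [IsProbabilityMeasure P]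

/-- The joint law is a product, so a tail bound valid for almost every frozen value of U integrates
to the same bound. This carries estimates for fixed vectors and matrices over to random ones. -/
theorem measure_pair_mem_le_of_indepFun {α β : Type*} [MeasurableSpace α]
    [MeasurableSpace β] {U : Ω → α} {V : Ω → β} (hUV : IndepFun U V P) (hU : AEMeasurable U P)
    (hV : AEMeasurable V P) {S : Set (α × β)} (hS : MeasurableSet S) {c : ℝ≥0∞}
    (hc : ∀ᵐ u ∂(P.map U), P.map V (Prod.mk u ⁻¹' S) ≤ c) :
    P {ω | (U ω, V ω) ∈ S} ≤ c := by
  have h1 : P {ω | (U ω, V ω) ∈ S} = P.map (fun ω => (U ω, V ω)) S :=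
    (Measure.map_apply_of_aemeasurable (hU.prodMk hV) hS).symm
  rw [h1, (indepFun_iff_map_prod_eq_prod_map_map hU hV).1 hUV, Measure.prod_apply hS]
  refine (lintegral_mono_ae hc).trans ?_
  rw [lintegral_const, Measure.map_apply_of_aemeasurable hU MeasurableSet.univ, Set.preimage_univ]
  exact mul_le_of_le_one_right' prob_le_one

theorem integrable_pow_four_of_lintegral_rpow_le {ξ : Ω → ℝ} (hm : Measurable ξ) {η : ℝ}
    (hη : 0 < η) {M : ℝ≥0} (hM : ∫⁻ ω, ‖ξ ω‖ₑ ^ (4 + η) ∂P ≤ M) :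
    Integrable (fun ω => ξ ω ^ 4) P ∧ ∫ ω, ξ ω ^ 4 ∂P ≤ 1 + M := by
  have h1 : ∫⁻ ω, ‖ξ ω ^ 4‖ₑ ∂P ≤ 1 + M := by
    calc ∫⁻ ω, ‖ξ ω ^ 4‖ₑ ∂P ≤ ∫⁻ ω, (1 + ‖ξ ω‖ₑ ^ (4 + η)) ∂P := by
          refine lintegral_mono fun ω => ?_
          rw [enorm_pow]
          rcases le_total ‖ξ ω‖ₑ 1 with h | h
          · exact (pow_le_one₀ (zero_le) h).trans le_self_add
          · have h2 : ‖ξ ω‖ₑ ^ (4 : ℝ) ≤ ‖ξ ω‖ₑ ^ (4 + η) :=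
              ENNReal.rpow_le_rpow_of_exponent_le h (by linarith)
            have h3 : ‖ξ ω‖ₑ ^ (4 : ℝ) = ‖ξ ω‖ₑ ^ 4 := by
              rw [← ENNReal.rpow_natCast]
              norm_num
            rw [← h3]
            exact h2.trans le_add_self
      _ = 1 + ∫⁻ ω, ‖ξ ω‖ₑ ^ (4 + η) ∂P := by
          rw [lintegral_add_left measurable_const]
          simp
      _ ≤ 1 + M := by gcongr
  have hi : Integrable (fun ω => ξ ω ^ 4) P :=
    ⟨(hm.pow_const 4).aestronglyMeasurable, h1.trans_lt (by finiteness)⟩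
  refine ⟨hi, ?_⟩
  have hM0 : (0 : ℝ) ≤ M := M.2
  have h2 : ENNReal.ofReal (∫ ω, ξ ω ^ 4 ∂P) ≤ ENNReal.ofReal (1 + M) := by
    rw [ofReal_integral_eq_lintegral_ofReal hi (ae_of_all _ fun ω => by positivity),
      ENNReal.ofReal_add zero_le_one hM0, ENNReal.ofReal_one, ENNReal.ofReal_coe_nnreal]
    refine le_trans (lintegral_mono fun ω => ?_) h1
    rw [Real.enorm_eq_ofReal (by positivity)]
  exact (ENNReal.ofReal_le_ofReal_iff (by positivity)).1 h2

/-! ### Summable tail bounds, uniform in the weights of the noise -/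

section Noise

variable {ε : (n : ℕ) → Ω → Fin n → ℝ} {σ η : ℝ}

/-- The sequence u is chosen before A, so A may later be a function of the design. -/
theorem exists_summable_measure_noise_quadraticForm_le
    (hε_meas : ∀ n, Measurable (ε n)) (hε_indep : ∀ n, iIndepFun (fun i ω => ε n ω i) P)
    (hε_mean : ∀ n i, ∫ ω, ε n ω i ∂P = 0) (hε_var : ∀ n i, ∫ ω, ε n ω i ^ 2 ∂P = σ ^ 2)
    (hη : 0 < η) {M : ℝ≥0} (hε_mom : ∀ n i, ∫⁻ ω, ‖ε n ω i‖ₑ ^ (4 + η) ∂P ≤ M)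
    {K t : ℝ} (hK : 0 ≤ K) (ht : 0 < t) :
    ∃ u : ℕ → ℝ, Summable u ∧ ∀ᶠ n in atTop, ∀ A : Matrix (Fin n) (Fin n) ℝ,
      (∀ i j, A i j = A j i) → (∀ i, ∑ j, A i j ^ 2 ≤ K ^ 2) →
      P {ω | t * n < |ε n ω ⬝ᵥ A *ᵥ ε n ω - σ ^ 2 * A.trace|} ≤ ENNReal.ofReal (u n) := by
  set m : ℝ := 1 + M + σ ^ 2 with hmdef
  have hM0 : (0 : ℝ) ≤ M := M.2
  have hm1 : 1 ≤ m := by rw [hmdef]; nlinarith [sq_nonneg σ]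
  -- Truncation at τ = n^α: α < 1 makes n^(2α − 3) summable (truncated diagonal), and α(4 + η)/2 > 2
  -- makes n^(1 − α(4 + η)/2) summable (union bound). This α meets both for every η > 0.
  set α : ℝ := 8 / (8 + η) with hα
  have hα1 : α < 1 := by rw [hα, div_lt_one (by linarith)]; linarith
  have hα0 : 0 < α := by rw [hα]; positivity
  have hα2 : 2 < α * ((4 + η) / 2) := by
    rw [hα, div_mul_eq_mul_div, lt_div_iff₀ (by linarith)]
    linarith
  set c : ℝ := (t / 3) ^ 4 with hc
  have hc0 : 0 < c := by positivity
  refine ⟨fun n => (1216 * (K ^ 2) ^ 2 * m ^ 4 / c + 3 * (K ^ 2 * m) ^ 2 / c) * (n : ℝ) ^ (-2 : ℝ) +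
    (K ^ 2) ^ 2 * m / c * (n : ℝ) ^ (2 * α - 3) + M * (n : ℝ) ^ (1 - α * ((4 + η) / 2)), ?_, ?_⟩
  · refine Summable.add (Summable.add ?_ ?_) ?_ <;>
      refine Summable.mul_left _ (Real.summable_nat_rpow.2 ?_) <;> linarith
  have hτlim : Tendsto (fun n : ℕ => K * (m / (n : ℝ) ^ α)) atTop (𝓝 0) := by
    have h1 : Tendsto (fun n : ℕ => (n : ℝ) ^ α) atTop atTop :=
      (tendsto_rpow_atTop hα0).comp tendsto_natCast_atTop_atTop
    simpa using (h1.const_div_atTop m).const_mul K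
  filter_upwards [hτlim.eventually (gt_mem_nhds (show 0 < t / 4 by positivity)),
    eventually_gt_atTop 0] with n hn1 hn A hA hAK
  have hn' : (0 : ℝ) < n := by exact_mod_cast hn
  have hτ : 0 < (n : ℝ) ^ α := Real.rpow_pos_of_pos hn' _
  have hmi : ∀ i, Measurable fun ω => ε n ω i := fun i => (measurable_pi_apply i).comp (hε_meas n)
  have hmom := fun i => integrable_pow_four_of_lintegral_rpow_le (hmi i) hη (hε_mom n i)
  have key := measure_noise_quadraticForm_le (P := P) (ξ := fun i ω => ε n ω i) hn (hε_indep n) hmi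
    (fun i => (hmom i).1) (hε_mean n) hm1 (by rw [hmdef]; linarith) (hε_var n)
    (fun i => (hmom i).2.trans (by rw [hmdef]; nlinarith [sq_nonneg σ])) hA hK hAK hτ ht hn1.le
    (q := M / ((n : ℝ) ^ α) ^ ((4 + η) / 2)) (by positivity)
    (fun i => measure_lt_sq_le_of_lintegral_rpow_le (hmi i) hη (hε_mom n i) hτ)
  refine key.trans (le_of_eq ?_)
  congr 1
  have e1 : (n : ℝ) ^ (-2 : ℝ) = (n : ℝ) ^ 2 / (n : ℝ) ^ 4 := by
    rw [Real.rpow_neg hn'.le, Real.rpow_two]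
    field_simp
  have e2 : (n : ℝ) ^ (2 * α - 3) = n * ((n : ℝ) ^ α) ^ 2 / (n : ℝ) ^ 4 := by
    rw [Real.rpow_sub hn', mul_comm 2 α, Real.rpow_mul hn'.le, Real.rpow_two,
      show (3 : ℝ) = ((3 : ℕ) : ℝ) by norm_num, Real.rpow_natCast]
    field_simp
  have e3 : (n : ℝ) ^ (1 - α * ((4 + η) / 2)) = n / ((n : ℝ) ^ α) ^ ((4 + η) / 2) := by
    rw [Real.rpow_sub hn', Real.rpow_one, Real.rpow_mul hn'.le]
  rw [e1, e2, e3, mul_pow (t / 3) (n : ℝ) 4, ← hc]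
  field_simp
  ring

theorem exists_summable_measure_noise_linearForm_le
    (hε_meas : ∀ n, Measurable (ε n)) (hε_indep : ∀ n, iIndepFun (fun i ω => ε n ω i) P)
    (hε_mean : ∀ n i, ∫ ω, ε n ω i ∂P = 0) (hε_var : ∀ n i, ∫ ω, ε n ω i ^ 2 ∂P = σ ^ 2)
    (hη : 0 < η) {M : ℝ≥0} (hε_mom : ∀ n i, ∫⁻ ω, ‖ε n ω i‖ₑ ^ (4 + η) ∂P ≤ M)
    {W t : ℝ} (ht : 0 < t) :
    ∃ u : ℕ → ℝ, Summable u ∧ ∀ n, 0 < n → ∀ w : Fin n → ℝ, w ⬝ᵥ w ≤ W * n →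
      P {ω | t * n < |w ⬝ᵥ ε n ω|} ≤ ENNReal.ofReal (u n) := by
  set m : ℝ := 1 + M + σ ^ 2 with hmdef
  have hM0 : (0 : ℝ) ≤ M := M.2
  have hm1 : 1 ≤ m := by rw [hmdef]; nlinarith [sq_nonneg σ]
  refine ⟨fun n => 4 * W ^ 2 * m ^ 2 / t ^ 4 * ((n : ℝ) ^ 2)⁻¹,
    (Real.summable_nat_pow_inv.2 one_lt_two).mul_left _, fun n hn w hw => ?_⟩
  have hn' : (0 : ℝ) < n := by exact_mod_cast hn
  have hmi : ∀ i, Measurable fun ω => ε n ω i := fun i => (measurable_pi_apply i).comp (hε_meas n)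
  have hmom := fun i => integrable_pow_four_of_lintegral_rpow_le (hmi i) hη (hε_mom n i)
  obtain ⟨h1, h2⟩ := integral_linear_pow_four_le (P := P) (ξ := fun i ω => ε n ω i) (hε_indep n) hmi
    (fun i => (hmom i).1) (hε_mean n) hm1
    (fun i => (hε_var n i).le.trans (by rw [hmdef]; linarith))
    (fun i => (hmom i).2.trans (by rw [hmdef]; nlinarith [sq_nonneg σ]))
    (a := w) (κ := W * n) (s := Finset.univ) (by simpa only [dotProduct, sq] using hw)
  refine (measure_mono fun ω hω => ?_).trans ((measure_abs_ge_le_of_pow_four h1 h2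
    (by positivity : 0 < t * n)).trans (le_of_eq ?_))
  · simp only [Set.mem_ofPred_eq] at hω ⊢
    exact hω.le
  · congr 1
    field_simp

end Noise

theorem measure_abs_signal_quadraticForm_le {n p : ℕ} {X : Ω → Matrix (Fin n) (Fin p) ℝ}
    (hX : RightRotationallyInvariant X P) {lam s : ℝ} (hlam : 0 < lam) (hs : 0 < s)
    (b : Fin p → ℝ) :
    P.map X {x | s * (b ⬝ᵥ b) < |b ⬝ᵥ signalMatrix x lam *ᵥ b -
        (signalMatrix x lam).trace / p * (b ⬝ᵥ b)|} ≤
      ENNReal.ofReal (2 * Real.exp (-(s ^ 2 / (8 * (2 * (1 / (4 * lam)) + s) ^ 2)) * p)) := by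
  obtain ⟨hm, hinv⟩ := map_mul_orthogonal_eq hX
  have : IsProbabilityMeasure (P.map X) := Measure.isProbabilityMeasure_map hm
  have hK : ∀ (x : Matrix (Fin n) (Fin p) ℝ) (u : Fin p → ℝ),
      |u ⬝ᵥ signalMatrix x lam *ᵥ u| ≤ 1 / (4 * lam) * (u ⬝ᵥ u) := by
    intro x u
    rw [dotProduct_signalMatrix_mulVec, abs_of_nonneg (dotProduct_self_nonneg' _),
      one_div_mul_eq_div, le_div_iff₀ (by positivity), mul_comm]
    exact gramResolvent_mulVec_mulVec_sq_le x hlam u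
  have h1 := measure_quadraticForm_le_of_invariant hinv (measurable_signalMatrix lam)
    (fun x O hO => signalMatrix_mul_orthogonal x lam hO) (fun x => signalMatrix_isHermitian x lam)
    (by positivity) hs hK b
  have h2 := measure_quadraticForm_le_of_invariant hinv
    (F := fun x => -signalMatrix x lam) (K := 1 / (4 * lam)) (s := s)
    (measurable_pi_iff.2 fun i => measurable_pi_iff.2 fun j => ((measurable_pi_apply j).comp
      ((measurable_pi_apply i).comp (measurable_signalMatrix lam))).neg)
    (fun x O hO => by rw [signalMatrix_mul_orthogonal x lam hO]; simp)
    (fun x => (signalMatrix_isHermitian x lam).neg)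
    (by positivity) hs (fun x u => by
      rw [Matrix.neg_mulVec, dotProduct_neg, abs_neg]
      exact hK x u) b
  rw [two_mul, ENNReal.ofReal_add (Real.exp_pos _).le (Real.exp_pos _).le]
  refine (measure_mono fun x hx => ?_).trans ((measure_union_le _ _).trans (add_le_add h1 h2))
  simp only [Set.mem_ofPred_eq, Set.mem_union, lt_abs] at hx ⊢
  refine hx.imp id fun h => h.trans_le (le_of_eq ?_)
  rw [Matrix.neg_mulVec, dotProduct_neg, Matrix.trace_neg]
  ring

/-- The growth p/log n → ∞ enters here: eventually p ≥ (2/c) log n, whatever the rate c > 0. -/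
theorem eventually_exp_neg_mul_le_of_log {p : ℕ → ℕ}
    (hp_log : Tendsto (fun n => (p n : ℝ) / Real.log n) atTop atTop) {c : ℝ} (hc : 0 < c) :
    ∀ᶠ n : ℕ in atTop, 2 * Real.exp (-c * p n) ≤ 2 * ((n : ℝ) ^ 2)⁻¹ := by
  filter_upwards [hp_log.eventually_ge_atTop (2 / c), eventually_gt_atTop 1] with n hn hn1
  have hn' : (1 : ℝ) < n := by exact_mod_cast hn1
  have hlog : 0 < Real.log n := Real.log_pos hn'
  rw [le_div_iff₀ hlog, div_mul_eq_mul_div, div_le_iff₀ hc] at hn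
  have h1 : ((n : ℝ) ^ 2)⁻¹ = Real.exp (-(2 * Real.log n)) := by
    rw [Real.exp_neg, two_mul, Real.exp_add, Real.exp_log (by linarith), sq]
  rw [h1]
  gcongr
  linarith

/-! ### The signal, cross and noise errors of the model -/

section Model

variable {p : ℕ → ℕ} {r σ η : ℝ} {X : (n : ℕ) → Ω → Matrix (Fin n) (Fin (p n)) ℝ}
  {β : (n : ℕ) → Ω → Fin (p n) → ℝ} {ε : (n : ℕ) → Ω → Fin n → ℝ}

theorem ae_tendsto_signal_part (hX : ∀ n, RightRotationallyInvariant (X n) P)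
    (hp_log : Tendsto (fun n => (p n : ℝ) / Real.log n) atTop atTop)
    (hβ_meas : ∀ n, Measurable (β n)) (hβ : ∀ n, 0 < n → ∀ᵐ ω ∂P, β n ω ⬝ᵥ β n ω = r ^ 2 * n)
    (hβX : ∀ n, IndepFun (X n) (β n) P) {lam : ℝ} (hlam : 0 < lam) :
    ∀ᵐ ω ∂P, Tendsto (fun n => (β n ω ⬝ᵥ signalMatrix (X n ω) lam *ᵥ β n ω -
      (signalMatrix (X n ω) lam).trace / p n * (β n ω ⬝ᵥ β n ω)) / n) atTop (𝓝 0) := by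
  refine ae_tendsto_zero_of_summable fun t ht => ?_
  -- Then s‖β‖² = s r² n ≤ tn; the added 1 covers r = 0.
  set s : ℝ := t / (r ^ 2 + 1) with hs
  have hs0 : 0 < s := by positivity
  refine ⟨fun n => 2 * ((n : ℝ) ^ 2)⁻¹, (Real.summable_nat_pow_inv.2 one_lt_two).mul_left _, ?_⟩
  filter_upwards [eventually_exp_neg_mul_le_of_log hp_log
    (show 0 < s ^ 2 / (8 * (2 * (1 / (4 * lam)) + s) ^ 2) by positivity),
    eventually_gt_atTop 0] with n hn hn0
  have hn' : (0 : ℝ) < n := by exact_mod_cast hn0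
  set S : Set ((Fin (p n) → ℝ) × Matrix (Fin n) (Fin (p n)) ℝ) :=
    {z | s * (z.1 ⬝ᵥ z.1) < |z.1 ⬝ᵥ signalMatrix z.2 lam *ᵥ z.1 -
      (signalMatrix z.2 lam).trace / p n * (z.1 ⬝ᵥ z.1)|} with hS
  have hSm : MeasurableSet S := by
    have h1 : Measurable fun z : (Fin (p n) → ℝ) × Matrix (Fin n) (Fin (p n)) ℝ =>
      signalMatrix z.2 lam := (measurable_signalMatrix lam).comp measurable_snd
    have h2 : Measurable fun z : (Fin (p n) → ℝ) × Matrix (Fin n) (Fin (p n)) ℝ => z.1 :=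
      measurable_fst
    have h3 := measurable_dotProduct h2 h2
    exact measurableSet_lt (h3.const_mul s)
      (((measurable_dotProduct h2 (measurable_matrix_mulVec h1 h2)).sub
        (((measurable_matrix_trace h1).div_const _).mul h3)).norm)
  have hP := measure_pair_mem_le_of_indepFun (hβX n).symm (hβ_meas n).aemeasurable
    (map_mul_orthogonal_eq (hX n)).1 hSm
    (ae_of_all _ fun b => (measure_abs_signal_quadraticForm_le (hX n) hlam hs0 b).trans
      (ENNReal.ofReal_le_ofReal hn))
  refine (measure_mono_ae ?_).trans hP
  filter_upwards [hβ n hn0] with ω hω hlt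
  change s * (β n ω ⬝ᵥ β n ω) < |_|
  have hlt' : t < |(β n ω ⬝ᵥ signalMatrix (X n ω) lam *ᵥ β n ω -
      (signalMatrix (X n ω) lam).trace / p n * (β n ω ⬝ᵥ β n ω)) / n| := hlt
  rw [abs_div, abs_of_pos hn', lt_div_iff₀ hn'] at hlt'
  refine lt_of_le_of_lt ?_ hlt'
  rw [hω, hs, div_mul_eq_mul_div, div_le_iff₀ (by positivity)]
  have : 0 < t * n := by positivity
  nlinarith

theorem ae_tendsto_cross_part (hX : ∀ n, RightRotationallyInvariant (X n) P)
    (hβ_meas : ∀ n, Measurable (β n)) (hβ : ∀ n, 0 < n → ∀ᵐ ω ∂P, β n ω ⬝ᵥ β n ω = r ^ 2 * n)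
    (hε_meas : ∀ n, Measurable (ε n)) (hε_indep : ∀ n, iIndepFun (fun i ω => ε n ω i) P)
    (hε_XB : ∀ n, IndepFun (fun ω => (X n ω, β n ω)) (ε n) P)
    (hε_mean : ∀ n i, ∫ ω, ε n ω i ∂P = 0) (hε_var : ∀ n i, ∫ ω, ε n ω i ^ 2 ∂P = σ ^ 2)
    (hη : 0 < η) {M : ℝ≥0} (hε_mom : ∀ n i, ∫⁻ ω, ‖ε n ω i‖ₑ ^ (4 + η) ∂P ≤ M)
    {lam : ℝ} (hlam : 0 < lam) :
    ∀ᵐ ω ∂P, Tendsto (fun n => ((gramResolvent (X n ω) lam *ᵥ (gramResolvent (X n ω) lam *ᵥ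
      (X n ω *ᵥ β n ω))) ⬝ᵥ ε n ω) / n) atTop (𝓝 0) := by
  refine ae_tendsto_zero_of_summable fun t ht => ?_
  obtain ⟨u, hu, hle⟩ := exists_summable_measure_noise_linearForm_le hε_meas hε_indep hε_mean
    hε_var hη hε_mom (W := r ^ 2 / (4 * lam ^ 3)) ht
  refine ⟨u, hu, ?_⟩
  filter_upwards [eventually_gt_atTop 0] with n hn
  have hn' : (0 : ℝ) < n := by exact_mod_cast hn
  set w : Matrix (Fin n) (Fin (p n)) ℝ × (Fin (p n) → ℝ) → Fin n → ℝ := fun z =>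
    gramResolvent z.1 lam *ᵥ (gramResolvent z.1 lam *ᵥ (z.1 *ᵥ z.2)) with hw
  have hwm : Measurable w := by
    have h1 : Measurable fun z : Matrix (Fin n) (Fin (p n)) ℝ × (Fin (p n) → ℝ) =>
      gramResolvent z.1 lam := (measurable_gramResolvent lam).comp measurable_fst
    exact measurable_matrix_mulVec h1 (measurable_matrix_mulVec h1
      (measurable_matrix_mulVec measurable_fst measurable_snd))
  -- One resolvent contributes λ⁻² and the factor RX contributes 1/(4λ), for every design.
  have hwle : ∀ z, z.2 ⬝ᵥ z.2 = r ^ 2 * n → w z ⬝ᵥ w z ≤ r ^ 2 / (4 * lam ^ 3) * n := by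
    intro z hz
    have h1 := gramResolvent_mulVec_sq_le z.1 hlam (gramResolvent z.1 lam *ᵥ (z.1 *ᵥ z.2))
    have h2 := gramResolvent_mulVec_mulVec_sq_le z.1 hlam z.2
    rw [hz] at h2
    rw [div_mul_eq_mul_div, le_div_iff₀ (by positivity)]
    calc w z ⬝ᵥ w z * (4 * lam ^ 3) = 4 * lam * (lam ^ 2 * (w z ⬝ᵥ w z)) := by ring
      _ ≤ _ := (mul_le_mul_of_nonneg_left h1 (by positivity)).trans h2
  have hSm : MeasurableSet {z : (Matrix (Fin n) (Fin (p n)) ℝ × (Fin (p n) → ℝ)) ×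
      (Fin n → ℝ) | t * n < |w z.1 ⬝ᵥ z.2|} :=
    measurableSet_lt measurable_const
      (measurable_dotProduct (hwm.comp measurable_fst) measurable_snd).norm
  have hXm := (map_mul_orthogonal_eq (hX n)).1
  have hUm : AEMeasurable (fun ω => (X n ω, β n ω)) P := hXm.prodMk (hβ_meas n).aemeasurable
  have hP := measure_pair_mem_le_of_indepFun (hε_XB n) hUm (hε_meas n).aemeasurable hSm
    (c := ENNReal.ofReal (u n)) ?_
  · refine (measure_mono fun ω hω => ?_).trans hP
    simp only [Set.mem_ofPred_eq] at hω ⊢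
    rwa [abs_div, abs_of_pos hn', lt_div_iff₀ hn'] at hω
  · have hset : MeasurableSet {z : Matrix (Fin n) (Fin (p n)) ℝ × (Fin (p n) → ℝ) |
        z.2 ⬝ᵥ z.2 = r ^ 2 * n} :=
      measurableSet_eq_fun (measurable_dotProduct measurable_snd measurable_snd) measurable_const
    have hae : ∀ᵐ z ∂(P.map fun ω => (X n ω, β n ω)), z.2 ⬝ᵥ z.2 = r ^ 2 * n :=
      (ae_map_iff hUm hset).2 (hβ n hn)
    filter_upwards [hae] with z hz
    rw [Measure.map_apply (hε_meas n) (measurable_prodMk_left hSm)]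
    exact hle n hn (w z) (hwle z hz)

theorem ae_tendsto_noise_part (hX : ∀ n, RightRotationallyInvariant (X n) P)
    (hε_meas : ∀ n, Measurable (ε n)) (hε_indep : ∀ n, iIndepFun (fun i ω => ε n ω i) P)
    (hε_X : ∀ n, IndepFun (X n) (ε n) P)
    (hε_mean : ∀ n i, ∫ ω, ε n ω i ∂P = 0) (hε_var : ∀ n i, ∫ ω, ε n ω i ^ 2 ∂P = σ ^ 2)
    (hη : 0 < η) {M : ℝ≥0} (hε_mom : ∀ n i, ∫⁻ ω, ‖ε n ω i‖ₑ ^ (4 + η) ∂P ≤ M)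
    {lam : ℝ} (hlam : 0 < lam) :
    ∀ᵐ ω ∂P, Tendsto (fun n => (ε n ω ⬝ᵥ (gramResolvent (X n ω) lam *
      gramResolvent (X n ω) lam) *ᵥ ε n ω - σ ^ 2 * (gramResolvent (X n ω) lam *
      gramResolvent (X n ω) lam).trace) / n) atTop (𝓝 0) := by
  refine ae_tendsto_zero_of_summable fun t ht => ?_
  obtain ⟨u, hu, hle⟩ := exists_summable_measure_noise_quadraticForm_le hε_meas hε_indep hε_mean
    hε_var hη hε_mom (K := (lam ^ 2)⁻¹) (by positivity) ht
  refine ⟨u, hu, ?_⟩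
  filter_upwards [hle, eventually_gt_atTop 0] with n hle hn
  have hn' : (0 : ℝ) < n := by exact_mod_cast hn
  set N : Matrix (Fin n) (Fin (p n)) ℝ → Matrix (Fin n) (Fin n) ℝ := fun x =>
    gramResolvent x lam * gramResolvent x lam with hN
  have hNm : Measurable N :=
    measurable_matrix_mul (measurable_gramResolvent lam) (measurable_gramResolvent lam)
  have hNt : ∀ x, (N x)ᵀ = N x := fun x => by
    simp [hN, Matrix.transpose_mul, gramResolvent_transpose]
  have hNsymm : ∀ x i j, N x i j = N x j i := fun x i j => by
    conv_lhs => rw [← hNt x, Matrix.transpose_apply]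
  -- By symmetry row i of R² is R²e_i, and R contracts by 1/λ twice.
  have hrow : ∀ x i, ∑ j, N x i j ^ 2 ≤ ((lam ^ 2)⁻¹) ^ 2 := by
    intro x i
    have h1 : ∑ j, N x i j ^ 2 = N x *ᵥ Pi.single i 1 ⬝ᵥ N x *ᵥ Pi.single i 1 := by
      rw [dotProduct]
      refine Finset.sum_congr rfl fun j _ => ?_
      rw [Matrix.mulVec_single_one, Matrix.col_apply, hNsymm x i j, sq]
    have h2 := gramResolvent_mulVec_sq_le x hlam (gramResolvent x lam *ᵥ Pi.single i 1)
    have h3 := gramResolvent_mulVec_sq_le x hlam (Pi.single i 1)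
    rw [Matrix.mulVec_mulVec] at h2
    rw [single_one_dotProduct, Pi.single_eq_same] at h3
    rw [h1, inv_pow, ← one_div, le_div_iff₀ (by positivity)]
    calc N x *ᵥ Pi.single i 1 ⬝ᵥ N x *ᵥ Pi.single i 1 * (lam ^ 2) ^ 2 =
        lam ^ 2 * (lam ^ 2 * (N x *ᵥ Pi.single i 1 ⬝ᵥ N x *ᵥ Pi.single i 1)) := by ring
      _ ≤ _ := (mul_le_mul_of_nonneg_left h2 (by positivity)).trans h3
  have hSm : MeasurableSet {z : Matrix (Fin n) (Fin (p n)) ℝ × (Fin n → ℝ) |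
      t * n < |z.2 ⬝ᵥ N z.1 *ᵥ z.2 - σ ^ 2 * (N z.1).trace|} := by
    have h1 : Measurable fun z : Matrix (Fin n) (Fin (p n)) ℝ × (Fin n → ℝ) => N z.1 :=
      hNm.comp measurable_fst
    exact measurableSet_lt measurable_const
      ((measurable_dotProduct measurable_snd (measurable_matrix_mulVec h1 measurable_snd)).sub
        ((measurable_matrix_trace h1).const_mul _)).norm
  have hP := measure_pair_mem_le_of_indepFun (hε_X n) (map_mul_orthogonal_eq (hX n)).1
    (hε_meas n).aemeasurable hSm (c := ENNReal.ofReal (u n)) (ae_of_all _ fun x => by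
      rw [Measure.map_apply (hε_meas n) (measurable_prodMk_left hSm)]
      exact hle (N x) (hNsymm x) (hrow x))
  refine (measure_mono fun ω hω => ?_).trans hP
  simp only [Set.mem_ofPred_eq] at hω ⊢
  rwa [abs_div, abs_of_pos hn', lt_div_iff₀ hn'] at hω

end Model

end AlmostSure

/-! ### Identifiability of the estimating equations -/

section Coefficients

variable {n p : ℕ}

/-- An exact identity at fixed n: ‖β‖² = r²n makes r²a the centring of the signal form, and σ²b is
that of the noise form. -/
theorem trainError_sub_eq {X : Matrix (Fin n) (Fin p) ℝ} {β : Fin p → ℝ} {ε : Fin n → ℝ}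
    {r σ lam : ℝ} (hn : 0 < n) (hlam : 0 < lam) (hβ : β ⬝ᵥ β = r ^ 2 * n) :
    trainError X (X *ᵥ β + ε) lam - (r ^ 2 * coefA X lam + σ ^ 2 * coefB X lam) =
      lam ^ 2 * ((β ⬝ᵥ signalMatrix X lam *ᵥ β - (signalMatrix X lam).trace / p * (β ⬝ᵥ β)) / n +
        2 * (((gramResolvent X lam *ᵥ (gramResolvent X lam *ᵥ (X *ᵥ β))) ⬝ᵥ ε) / n) +
        (ε ⬝ᵥ (gramResolvent X lam * gramResolvent X lam) *ᵥ ε -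
          σ ^ 2 * (gramResolvent X lam * gramResolvent X lam).trace) / n) := by
  have hn' : (n : ℝ) ≠ 0 := by exact_mod_cast hn.ne'
  rw [trainError, sub_mulVec_ridge X _ hlam, norm_toLp_sq, coefA_eq X hlam, coefB_eq X hlam,
    ← trace_signalMatrix X hlam, ← trace_gramResolvent_sq X hlam, hβ,
    dotProduct_signalMatrix_mulVec, ← Matrix.mulVec_mulVec ε, ← dotProduct_gramResolvent_mulVec X ε,
    dotProduct_gramResolvent_mulVec X (gramResolvent X lam *ᵥ (X *ᵥ β)), Matrix.mulVec_add]
  simp only [smul_dotProduct, dotProduct_smul, add_dotProduct, dotProduct_add, smul_eq_mul]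
  rw [dotProduct_comm (gramResolvent X lam *ᵥ ε) (gramResolvent X lam *ᵥ (X *ᵥ β)), inv_div]
  field_simp
  ring

/-- Each of the p diagonal entries of the signal matrix is at most 1/(4λ), and a averages them over
p. The bound thus holds even as γ_n → 0. -/
theorem coefA_le (X : Matrix (Fin n) (Fin p) ℝ) (hn : 0 < n) (hp : 0 < p) {lam : ℝ}
    (hlam : 0 < lam) : coefA X lam ≤ lam / 4 := by
  have hn' : (0 : ℝ) < n := by exact_mod_cast hn
  have hp' : (0 : ℝ) < p := by exact_mod_cast hp
  rw [coefA_eq X hlam, ← trace_signalMatrix X hlam]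
  have h1 : (signalMatrix X lam).trace ≤ ∑ _i : Fin p, 1 / (4 * lam) := by
    refine Finset.sum_le_sum fun i _ => ?_
    have h2 := gramResolvent_mulVec_mulVec_sq_le X hlam (Pi.single i 1)
    rw [← dotProduct_signalMatrix_mulVec, Matrix.mulVec_single_one, single_one_dotProduct,
      single_one_dotProduct, Pi.single_eq_same, Matrix.col_apply] at h2
    rw [Matrix.diag_apply, le_div_iff₀ (by positivity)]
    linarith
  rw [Finset.sum_const, Finset.card_univ, Fintype.card_fin, nsmul_eq_mul] at h1
  calc lam ^ 2 * (((p : ℝ) / n)⁻¹ * ((n : ℝ)⁻¹ * (signalMatrix X lam).trace))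
      ≤ lam ^ 2 * (((p : ℝ) / n)⁻¹ * ((n : ℝ)⁻¹ * (p * (1 / (4 * lam))))) := by gcongr
    _ = lam / 4 := by field_simp

theorem coefA_nonneg (X : Matrix (Fin n) (Fin p) ℝ) {lam : ℝ} (hlam : 0 < lam) :
    0 ≤ coefA X lam := by
  rw [coefA_eq X hlam]
  have : 0 ≤ ∑ i, companionEigenvalue X i * ((companionEigenvalue X i + lam) ^ 2)⁻¹ :=
    Finset.sum_nonneg fun i _ => by
      have := companionEigenvalue_nonneg X i
      positivity
  positivity

theorem coefB_nonneg (X : Matrix (Fin n) (Fin p) ℝ) {lam : ℝ} (hlam : 0 < lam) :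
    0 ≤ coefB X lam := by
  rw [coefB_eq X hlam]
  positivity

theorem coefB_le (X : Matrix (Fin n) (Fin p) ℝ) (hn : 0 < n) {lam : ℝ} (hlam : 0 < lam) :
    coefB X lam ≤ 1 := by
  have hn' : (0 : ℝ) < n := by exact_mod_cast hn
  rw [coefB_eq X hlam]
  have h1 : ∑ i, ((companionEigenvalue X i + lam) ^ 2)⁻¹ ≤ ∑ _i : Fin n, (lam ^ 2)⁻¹ := by
    refine Finset.sum_le_sum fun i _ => ?_
    have := companionEigenvalue_nonneg X i
    gcongr
    linarith
  rw [Finset.sum_const, Finset.card_univ, Fintype.card_fin, nsmul_eq_mul] at h1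
  calc lam ^ 2 * ((n : ℝ)⁻¹ * ∑ i, ((companionEigenvalue X i + lam) ^ 2)⁻¹)
      ≤ lam ^ 2 * ((n : ℝ)⁻¹ * (n * (lam ^ 2)⁻¹)) := by gcongr
    _ = 1 := by field_simp

theorem le_coefB (X : Matrix (Fin n) (Fin p) ℝ) (hn : 0 < n) {lam D : ℝ} (hlam : 0 < lam)
    (hD : ∀ i, companionEigenvalue X i ≤ D) : lam ^ 2 / (D + lam) ^ 2 ≤ coefB X lam := by
  have hn' : (0 : ℝ) < n := by exact_mod_cast hn
  rw [coefB_eq X hlam]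
  have h1 : ∑ _i : Fin n, ((D + lam) ^ 2)⁻¹ ≤ ∑ i, ((companionEigenvalue X i + lam) ^ 2)⁻¹ := by
    refine Finset.sum_le_sum fun i _ => ?_
    have := companionEigenvalue_nonneg X i
    gcongr
    exact hD i
  rw [Finset.sum_const, Finset.card_univ, Fintype.card_fin, nsmul_eq_mul] at h1
  calc lam ^ 2 / (D + lam) ^ 2 = lam ^ 2 * ((n : ℝ)⁻¹ * (n * ((D + lam) ^ 2)⁻¹)) := by field_simp
    _ ≤ _ := by gcongr

theorem pos_of_le_variance_div {X : Matrix (Fin n) (Fin p) ℝ} {c : ℝ} (hc : 0 < c)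
    (hv : c ≤ Var[id; companionSpectralMeasure X] / ((p : ℝ) / n)) : 0 < p := by
  rcases Nat.eq_zero_or_pos p with rfl | hp
  · simp only [Nat.cast_zero, zero_div, div_zero] at hv
    linarith
  · exact hp

/-- The variance is at most the second moment, and d² ≤ Dd ≤ D(D + λ)² · d/(d + λ)². Both sides
carry the factor 1/γ_n. -/
theorem le_coefA {X : Matrix (Fin n) (Fin p) ℝ} (hn : 0 < n) {lam D c : ℝ} (hlam : 0 < lam)
    (hD0 : 0 < D) (hD : ∀ i, companionEigenvalue X i ≤ D) (hc : 0 < c)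
    (hv : c ≤ Var[id; companionSpectralMeasure X] / ((p : ℝ) / n)) :
    lam ^ 2 * c / (D * (D + lam) ^ 2) ≤ coefA X lam := by
  have hn' : (0 : ℝ) < n := by exact_mod_cast hn
  have hp' : (0 : ℝ) < p := by exact_mod_cast pos_of_le_variance_div hc hv
  have hg : 0 < (p : ℝ) / n := by positivity
  rw [variance_companionSpectralMeasure X hn, le_div_iff₀ hg] at hv
  have h1 : c * ((p : ℝ) / n) ≤ (n : ℝ)⁻¹ * ∑ i, companionEigenvalue X i ^ 2 :=
    hv.trans (sub_le_self _ (sq_nonneg _))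
  have h2 : ∑ i, companionEigenvalue X i ^ 2 ≤
      D * (D + lam) ^ 2 *
        ∑ i, companionEigenvalue X i * ((companionEigenvalue X i + lam) ^ 2)⁻¹ := by
    rw [Finset.mul_sum]
    refine Finset.sum_le_sum fun i _ => ?_
    have h0 := companionEigenvalue_nonneg X i
    have h3 : 1 ≤ (D + lam) ^ 2 * ((companionEigenvalue X i + lam) ^ 2)⁻¹ := by
      rw [← div_eq_mul_inv, one_le_div (by positivity)]
      gcongr
      exact hD i
    calc companionEigenvalue X i ^ 2 = companionEigenvalue X i * companionEigenvalue X i * 1 := by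
          ring
      _ ≤ D * companionEigenvalue X i *
          ((D + lam) ^ 2 * ((companionEigenvalue X i + lam) ^ 2)⁻¹) := by
          gcongr
          exact hD i
      _ = _ := by ring
  rw [coefA_eq X hlam, div_le_iff₀ (by positivity)]
  have h4 : c ≤ ((p : ℝ) / n)⁻¹ * ((n : ℝ)⁻¹ * (D * (D + lam) ^ 2 *
      ∑ i, companionEigenvalue X i * ((companionEigenvalue X i + lam) ^ 2)⁻¹)) := by
    rw [inv_mul_eq_div, le_div_iff₀ hg]
    exact h1.trans (by gcongr)
  calc lam ^ 2 * c ≤ lam ^ 2 * _ := mul_le_mul_of_nonneg_left h4 (sq_nonneg _)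
    _ = _ := by ring

/-- Over a common denominator the numerator is a difference of squares with factor (x + λ)(y + μ) −
(x + μ)(y + λ) = (μ − λ)(x − y), so the product with x − y is nonnegative. -/
theorem sub_mul_inv_sq_cross_ge {x y lam mu D : ℝ} (hx : 0 ≤ x) (hy : 0 ≤ y) (hxD : x ≤ D)
    (hyD : y ≤ D) (hlam : 0 < lam) (hmu : lam < mu) :
    2 * lam * mu * (mu - lam) / (D + mu) ^ 8 * (x - y) ^ 2 ≤
      (x - y) * (((x + mu) ^ 2)⁻¹ * ((y + lam) ^ 2)⁻¹ - ((x + lam) ^ 2)⁻¹ * ((y + mu) ^ 2)⁻¹) := by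
  have hmu0 : 0 < mu := hlam.trans hmu
  have hsub : 0 < mu - lam := by linarith
  have hden : (x + lam) ^ 2 * (y + mu) ^ 2 * ((x + mu) ^ 2 * (y + lam) ^ 2) ≤ (D + mu) ^ 8 := by
    calc (x + lam) ^ 2 * (y + mu) ^ 2 * ((x + mu) ^ 2 * (y + lam) ^ 2)
        ≤ (D + mu) ^ 2 * (D + mu) ^ 2 * ((D + mu) ^ 2 * (D + mu) ^ 2) := by gcongr
      _ = _ := by ring
  have heq : (x - y) *
      (((x + mu) ^ 2)⁻¹ * ((y + lam) ^ 2)⁻¹ - ((x + lam) ^ 2)⁻¹ * ((y + mu) ^ 2)⁻¹) =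
      (mu - lam) * (x - y) ^ 2 * ((x + lam) * (y + mu) + (x + mu) * (y + lam)) /
        ((x + lam) ^ 2 * (y + mu) ^ 2 * ((x + mu) ^ 2 * (y + lam) ^ 2)) := by
    field_simp
    ring
  rw [heq, div_mul_eq_mul_div]
  have hnum : 2 * lam * mu ≤ (x + lam) * (y + mu) + (x + mu) * (y + lam) := by
    have h1 : 0 ≤ x * y := mul_nonneg hx hy
    have h2 : 0 ≤ x * mu := mul_nonneg hx hmu0.le
    have h3 : 0 ≤ lam * y := mul_nonneg hlam.le hy
    have h4 : 0 ≤ x * lam := mul_nonneg hx hlam.le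
    have h5 : 0 ≤ mu * y := mul_nonneg hmu0.le hy
    nlinarith
  refine div_le_div₀ (by positivity) ?_ (by positivity) hden
  calc 2 * lam * mu * (mu - lam) * (x - y) ^ 2 =
      (mu - lam) * (x - y) ^ 2 * (2 * lam * mu) := by ring
    _ ≤ _ := by gcongr

/-- Chebyshev-type symmetrization: twice the determinant is a double sum over pairs of eigenvalues,
each term of which dominates a multiple of (d_i − d_j)². Those squares sum to 2n² times the
variance. -/
theorem le_coef_cross {X : Matrix (Fin n) (Fin p) ℝ} (hn : 0 < n) {lam mu D c : ℝ}
    (hlam : 0 < lam) (hmu : lam < mu) (hD0 : 0 < D) (hD : ∀ i, companionEigenvalue X i ≤ D)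
    (hc : 0 < c) (hv : c ≤ Var[id; companionSpectralMeasure X] / ((p : ℝ) / n)) :
    lam ^ 2 * mu ^ 2 * (2 * lam * mu * (mu - lam) / (D + mu) ^ 8 * c) ≤
      coefA X mu * coefB X lam - coefA X lam * coefB X mu := by
  have hmu0 : 0 < mu := hlam.trans hmu
  have hn' : (0 : ℝ) < n := by exact_mod_cast hn
  have hp' : (0 : ℝ) < p := by exact_mod_cast pos_of_le_variance_div hc hv
  have hg : 0 < (p : ℝ) / n := by positivity
  set d := companionEigenvalue X with hd
  set k : ℝ := 2 * lam * mu * (mu - lam) / (D + mu) ^ 8 with hk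
  have hk0 : 0 < k := by
    have : 0 < mu - lam := by linarith
    positivity
  have hvar : 2 * (n : ℝ) ^ 2 * Var[id; companionSpectralMeasure X] =
      ∑ i, ∑ j, (d i - d j) ^ 2 := by
    rw [variance_companionSpectralMeasure X hn]
    have : ∀ i j, (d i - d j) ^ 2 = d i ^ 2 - 2 * (d i * d j) + d j ^ 2 := fun i j => by ring
    simp only [this, Finset.sum_add_distrib, Finset.sum_sub_distrib, ← Finset.mul_sum,
      ← Finset.sum_mul, Finset.sum_const, Finset.card_univ, Fintype.card_fin, nsmul_eq_mul]
    field_simp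
    ring
  set wl : Fin n → ℝ := fun i => ((d i + lam) ^ 2)⁻¹ with hwl
  set wm : Fin n → ℝ := fun i => ((d i + mu) ^ 2)⁻¹ with hwm
  have hcross : 2 * ((∑ i, d i * wm i) * (∑ i, wl i) - (∑ i, d i * wl i) * (∑ i, wm i)) =
      ∑ i, ∑ j, (d i - d j) * (wm i * wl j - wl i * wm j) := by
    have h1 : ∀ i j, (d i - d j) * (wm i * wl j - wl i * wm j) =
        d i * wm i * wl j - d i * wl i * wm j - wm i * (d j * wl j) + wl i * (d j * wm j) :=
      fun i j => by ring
    simp only [h1, Finset.sum_add_distrib, Finset.sum_sub_distrib, ← Finset.mul_sum,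
      ← Finset.sum_mul]
    ring
  have hge : k * ∑ i, ∑ j, (d i - d j) ^ 2 ≤
      ∑ i, ∑ j, (d i - d j) * (wm i * wl j - wl i * wm j) := by
    simp only [Finset.mul_sum]
    exact Finset.sum_le_sum fun i _ => Finset.sum_le_sum fun j _ =>
      sub_mul_inv_sq_cross_ge (companionEigenvalue_nonneg X i) (companionEigenvalue_nonneg X j)
        (hD i) (hD j) hlam hmu
  rw [← hvar, ← hcross] at hge
  have heq : coefA X mu * coefB X lam - coefA X lam * coefB X mu =
      lam ^ 2 * mu ^ 2 * (((p : ℝ) / n)⁻¹ * ((n : ℝ) ^ 2)⁻¹ *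
        ((∑ i, d i * wm i) * (∑ i, wl i) - (∑ i, d i * wl i) * (∑ i, wm i))) := by
    rw [coefA_eq X hmu0, coefB_eq X hlam, coefA_eq X hlam, coefB_eq X hmu0]
    ring
  rw [heq]
  have h3 : k * Var[id; companionSpectralMeasure X] ≤ ((n : ℝ) ^ 2)⁻¹ *
      ((∑ i, d i * wm i) * (∑ i, wl i) - (∑ i, d i * wl i) * (∑ i, wm i)) := by
    rw [inv_mul_eq_div, le_div_iff₀ (by positivity)]
    linarith
  refine mul_le_mul_of_nonneg_left ?_ (by positivity)
  calc k * c ≤ k * (Var[id; companionSpectralMeasure X] / ((p : ℝ) / n)) := by gcongr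
    _ = ((p : ℝ) / n)⁻¹ * (k * Var[id; companionSpectralMeasure X]) := by
      rw [div_eq_mul_inv]
      ring
    _ ≤ ((p : ℝ) / n)⁻¹ * _ := mul_le_mul_of_nonneg_left h3 (by positivity)
    _ = _ := by ring

theorem exists_pos_le_abs_coef_cross {lam mu D c : ℝ} (hlam : 0 < lam) (hmu : 0 < mu)
    (hne : lam ≠ mu) (hD0 : 0 < D) (hc : 0 < c) :
    ∃ κ > 0, ∀ {n p : ℕ} (X : Matrix (Fin n) (Fin p) ℝ), 0 < n →
      (∀ i, companionEigenvalue X i ≤ D) →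
      c ≤ Var[id; companionSpectralMeasure X] / ((p : ℝ) / n) →
      κ ≤ |coefA X lam * coefB X mu - coefA X mu * coefB X lam| := by
  rcases lt_or_gt_of_ne hne with h | h
  · have h1 : 0 < mu - lam := by linarith
    refine ⟨lam ^ 2 * mu ^ 2 * (2 * lam * mu * (mu - lam) / (D + mu) ^ 8 * c), by positivity,
      fun X hn hX hv => ?_⟩
    rw [abs_sub_comm]
    exact (le_coef_cross hn hlam h hD0 hX hc hv).trans (le_abs_self _)
  · have h1 : 0 < lam - mu := by linarith
    exact ⟨mu ^ 2 * lam ^ 2 * (2 * mu * lam * (lam - mu) / (D + lam) ^ 8 * c), by positivity,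
      fun X hn hX hv => (le_coef_cross hn hmu h hD0 hX hc hv).trans (le_abs_self _)⟩

end Coefficients

/-! ### Stability of the least-squares slopes and consistency -/

theorem companionEigenvalue_le_of_maxSingularValue_lt {n p : ℕ} {X : Matrix (Fin n) (Fin p) ℝ}
    {C : ℝ≥0} (h : maxSingularValue X < C) (i : Fin n) : companionEigenvalue X i ≤ C ^ 2 := by
  have h1 : ENNReal.ofReal √(companionEigenvalue X i) ≤ C :=
    (le_iSup (fun i => ENNReal.ofReal √(companionEigenvalue X i)) i).trans h.le
  rw [← ENNReal.ofReal_coe_nnreal, ENNReal.ofReal_le_ofReal_iff C.coe_nonneg] at h1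
  exact (Real.sqrt_le_left C.coe_nonneg).1 h1

/-- Consistency of the centred least-squares slope of `t / a` against `b / a` when
`t = ρ a + s b + o(1)`. -/
theorem tendsto_slope {L : ℕ} {a b t : ℕ → Fin (L + 1) → ℝ} {ρ s : ℝ}
    (ht : ∀ i, Tendsto (fun n => t n i - (ρ * a n i + s * b n i)) atTop (𝓝 0))
    {a₀ a₁ b₁ κ : ℝ} (ha₀ : 0 < a₀) (hκ : 0 < κ) {j : Fin (L + 1)}
    (h : ∀ᶠ n in atTop, (∀ i, a₀ ≤ a n i ∧ a n i ≤ a₁ ∧ 0 ≤ b n i ∧ b n i ≤ b₁) ∧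
      κ ≤ |a n j * b n 0 - a n 0 * b n j|) :
    Tendsto (fun n => (∑ i, (t n i / a n i - t n 0 / a n 0) * (b n i / a n i - b n 0 / a n 0)) /
      ∑ i, (b n i / a n i - b n 0 / a n 0) ^ 2) atTop (𝓝 s) := by
  set e : ℕ → Fin (L + 1) → ℝ := fun n i => t n i - (ρ * a n i + s * b n i) with he
  set v : ℕ → Fin (L + 1) → ℝ := fun n i => b n i / a n i - b n 0 / a n 0 with hv
  set V : ℝ := b₁ / a₀ with hV
  set κ' : ℝ := (κ / a₁ ^ 2) ^ 2 with hκ'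
  have hlim : Tendsto (fun n => ∑ i, (|e n i| + |e n 0|) / a₀ * V / κ') atTop (𝓝 0) := by
    have h1 : ∀ i ∈ Finset.univ, Tendsto (fun n => (|e n i| + |e n 0|) / a₀ * V / κ') atTop
        (𝓝 ((|(0 : ℝ)| + |(0 : ℝ)|) / a₀ * V / κ')) := fun i _ =>
      ((((ht i).abs.add (ht 0).abs).div_const _).mul_const _).div_const _
    simpa using tendsto_finsetSum _ h1
  rw [tendsto_iff_norm_sub_tendsto_zero]
  refine squeeze_zero' (Eventually.of_forall fun n => norm_nonneg _) ?_ hlim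
  filter_upwards [h] with n hn
  obtain ⟨hb, hκn⟩ := hn
  have ha : ∀ i, 0 < a n i := fun i => ha₀.trans_le (hb i).1
  have ha₁ : 0 < a₁ := (ha 0).trans_le (hb 0).2.1
  have hb₁ : 0 ≤ b₁ := (hb 0).2.2.1.trans (hb 0).2.2.2
  have hquot : ∀ i, 0 ≤ b n i / a n i ∧ b n i / a n i ≤ V := fun i =>
    ⟨div_nonneg (hb i).2.2.1 (ha i).le, div_le_div₀ hb₁ (hb i).2.2.2 ha₀ (hb i).1⟩
  have hvV : ∀ i, |v n i| ≤ V := by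
    intro i
    simp only [hv]
    rw [abs_le]
    constructor <;> linarith [(hquot i).1, (hquot i).2, (hquot 0).1, (hquot 0).2]
  have hκ'0 : 0 < κ' := by positivity
  -- The single term j is enough: v n j is, up to sign, the determinant divided by a_j a_0 ≤ a₁².
  have hS : κ' ≤ ∑ i, v n i ^ 2 := by
    refine le_trans ?_ (Finset.single_le_sum (f := fun i => v n i ^ 2) (fun i _ => sq_nonneg _)
      (Finset.mem_univ j))
    have h1 : |v n j| = |a n j * b n 0 - a n 0 * b n j| / (a n j * a n 0) := by
      have h2 : v n j = -(a n j * b n 0 - a n 0 * b n j) / (a n j * a n 0) := by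
        have h3 := (ha j).ne'
        have h4 := (ha 0).ne'
        simp only [hv]
        field_simp
        ring
      rw [h2, abs_div, abs_neg, abs_of_pos (mul_pos (ha j) (ha 0))]
    have h5 : κ / a₁ ^ 2 ≤ |v n j| := by
      rw [h1, sq]
      exact div_le_div₀ (abs_nonneg _) hκn (mul_pos (ha j) (ha 0))
        (mul_le_mul (hb j).2.1 (hb 0).2.1 (ha 0).le ha₁.le)
    rw [hκ', ← sq_abs (v n j)]
    gcongr
  have hS0 : 0 < ∑ i, v n i ^ 2 := hκ'0.trans_le hS
  -- Dividing by a makes the ρ part constant in i, so centring cancels it; subtracting s leaves only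
  -- the errors e.
  have hdiff : (∑ i, (t n i / a n i - t n 0 / a n 0) * v n i) / (∑ i, v n i ^ 2) - s =
      (∑ i, (e n i / a n i - e n 0 / a n 0) * v n i) / ∑ i, v n i ^ 2 := by
    rw [div_sub' hS0.ne']
    congr 1
    rw [mul_comm, Finset.mul_sum, ← Finset.sum_sub_distrib]
    refine Finset.sum_congr rfl fun i _ => ?_
    have h3 := (ha i).ne'
    have h4 := (ha 0).ne'
    simp only [he, hv]
    field_simp
    ring
  change ‖(∑ i, (t n i / a n i - t n 0 / a n 0) * v n i) / (∑ i, v n i ^ 2) - s‖ ≤ _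
  rw [hdiff, Real.norm_eq_abs, abs_div, abs_of_pos hS0, ← Finset.sum_div]
  refine div_le_div₀ (Finset.sum_nonneg fun i _ => ?_) ?_ hκ'0 hS
  · have : 0 ≤ V := (hquot 0).1.trans (hquot 0).2
    positivity
  · refine (Finset.abs_sum_le_sum_abs _ _).trans (Finset.sum_le_sum fun i _ => ?_)
    rw [abs_mul]
    refine mul_le_mul ?_ (hvV i) (abs_nonneg _) (by positivity)
    refine (abs_sub _ _).trans ?_
    rw [abs_div, abs_div, abs_of_pos (ha i), abs_of_pos (ha 0), add_div]
    exact add_le_add (div_le_div_of_nonneg_left (abs_nonneg _) ha₀ (hb i).1)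
      (div_le_div_of_nonneg_left (abs_nonneg _) ha₀ (hb 0).1)

theorem mainTheorem5 {Ω : Type*} [MeasurableSpace Ω] (P : Measure Ω) [IsProbabilityMeasure P]
    (p : ℕ → ℕ) (γ r σ η : ℝ)
    (X : (n : ℕ) → Ω → Matrix (Fin n) (Fin (p n)) ℝ)
    (β : (n : ℕ) → Ω → Fin (p n) → ℝ)
    (ε y : (n : ℕ) → Ω → Fin n → ℝ)
    -- the linear model
    (hy : ∀ n ω, y n ω = X n ω *ᵥ β n ω + ε n ω)
    -- the designs: right-rotationally invariant, with almost surely bounded singular values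
    (hX : ∀ n, RightRotationallyInvariant (X n) P)
    (hX_bdd : ∃ C : ℝ≥0, ∀ᵐ ω ∂P, limsup (fun n => maxSingularValue (X n ω)) atTop < C)
    -- proportional asymptotics; the second condition only matters when `γ = 0`
    (hp : Tendsto (fun n => (p n : ℝ) / n) atTop (𝓝 γ))
    (hp_log : Tendsto (fun n => (p n : ℝ) / Real.log n) atTop atTop)
    -- the signals: fixed or random, independent of the design, of norm `r √n`
    (hβ_meas : ∀ n, Measurable (β n))
    (hβ_norm : ∀ n, 0 < n → ∀ᵐ ω ∂P, ‖WithLp.toLp 2 (β n ω)‖ / √n = r)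
    (hβX : ∀ n, IndepFun (X n) (β n) P)
    -- the noise: independent entries, independent of the design and of the signal
    (hε_meas : ∀ n, Measurable (ε n))
    (hε_indep : ∀ n, iIndepFun (fun i ω => ε n ω i) P)
    (hε_XB : ∀ n, IndepFun (fun ω => (X n ω, β n ω)) (ε n) P)
    (hε_mean : ∀ n i, ∫ ω, ε n ω i ∂P = 0)
    (hε_var : ∀ n i, ∫ ω, ε n ω i ^ 2 ∂P = σ ^ 2)
    (hη : 0 < η)
    (hε_mom : ∃ M : ℝ≥0, ∀ n i, ∫⁻ ω, ‖ε n ω i‖ₑ ^ (4 + η) ∂P ≤ M)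
    -- the grid of regularization strengths, not all equal
    (L : ℕ) (lam : Fin (L + 1) → ℝ) (hlam : ∀ i, 0 < lam i) (hlam_ne : ∃ i j, lam i ≠ lam j)
    -- nondegenerate spectrum, without which the estimating equations do not identify `r²` and `σ²`
    (hspec : ∀ᵐ ω ∂P, ∃ c > 0, ∀ᶠ n in atTop,
      c ≤ Var[id; companionSpectralMeasure (X n ω)] / ((p n : ℝ) / n)) :
    (∀ᵐ ω ∂P, Tendsto (fun n => rSqHat lam (X n ω) (y n ω)) atTop (𝓝 (r ^ 2))) ∧
      (∀ᵐ ω ∂P, Tendsto (fun n => sigmaSqHat lam (X n ω) (y n ω)) atTop (𝓝 (σ ^ 2))) := by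
  obtain ⟨C, hC⟩ := hX_bdd
  obtain ⟨M, hM⟩ := hε_mom
  have hβ : ∀ n, 0 < n → ∀ᵐ ω ∂P, β n ω ⬝ᵥ β n ω = r ^ 2 * n := by
    intro n hn
    filter_upwards [hβ_norm n hn] with ω hω
    have hn' : (0 : ℝ) < n := by exact_mod_cast hn
    rw [div_eq_iff (Real.sqrt_pos.2 hn').ne'] at hω
    rw [← norm_toLp_sq, hω, mul_pow, Real.sq_sqrt hn'.le]
  have hβ' : ∀ᵐ ω ∂P, ∀ n, 0 < n → β n ω ⬝ᵥ β n ω = r ^ 2 * n :=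
    ae_all_iff.2 fun n => by
      rcases Nat.eq_zero_or_pos n with rfl | hn
      · simp
      · filter_upwards [hβ n hn] with ω hω _ using hω
  have hε_X : ∀ n, IndepFun (X n) (ε n) P := fun n =>
    (hε_XB n).comp (φ := Prod.fst) (ψ := id) measurable_fst measurable_id
  have hlim : ∀ᵐ ω ∂P, ∀ i, Tendsto (fun n => trainError (X n ω) (y n ω) (lam i) -
      (r ^ 2 * coefA (X n ω) (lam i) + σ ^ 2 * coefB (X n ω) (lam i))) atTop (𝓝 0) := by
    refine ae_all_iff.2 fun i => ?_
    filter_upwards [hβ', ae_tendsto_signal_part hX hp_log hβ_meas hβ hβX (hlam i),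
      ae_tendsto_cross_part hX hβ_meas hβ hε_meas hε_indep hε_XB hε_mean hε_var hη hM (hlam i),
      ae_tendsto_noise_part hX hε_meas hε_indep hε_X hε_mean hε_var hη hM (hlam i)]
      with ω hω h1 h2 h3
    have h4 := ((h1.add (h2.const_mul 2)).add h3).const_mul (lam i ^ 2)
    simp only [mul_zero, add_zero] at h4
    refine h4.congr' ?_
    filter_upwards [eventually_gt_atTop 0] with n hn
    rw [hy n ω]
    exact (trainError_sub_eq hn (hlam i) (hω n hn)).symm
  -- The estimators are centred at grid point 0, so a point differing from that one is needed.
  obtain ⟨j, hj⟩ : ∃ j, lam j ≠ lam 0 := by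
    by_contra! hcon
    obtain ⟨i, i', hii⟩ := hlam_ne
    exact hii ((hcon i).trans (hcon i').symm)
  have hmain : ∀ᵐ ω ∂P, Tendsto (fun n => rSqHat lam (X n ω) (y n ω)) atTop (𝓝 (r ^ 2)) ∧
      Tendsto (fun n => sigmaSqHat lam (X n ω) (y n ω)) atTop (𝓝 (σ ^ 2)) := by
    filter_upwards [hlim, hC, hspec] with ω h1 h2 h3
    obtain ⟨c, hc, h3⟩ := h3
    -- Adding 1 keeps D positive when C = 0. The constant c depends on ω, hence so do κ and lmin,
    -- which is harmless for an almost sure limit.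
    set D : ℝ := C ^ 2 + 1 with hD
    have hD0 : 0 < D := by positivity
    obtain ⟨κ, hκ, hcross⟩ := exists_pos_le_abs_coef_cross (hlam j) (hlam 0) hj hD0 hc
    obtain ⟨lmin, hlmin, hle⟩ : ∃ l > 0, ∀ i, l ≤ lam i ^ 2 * c / (D * (D + lam i) ^ 2) ∧
        l ≤ lam i ^ 2 / (D + lam i) ^ 2 := by
      set f : Fin (L + 1) → ℝ := fun i =>
        min (lam i ^ 2 * c / (D * (D + lam i) ^ 2)) (lam i ^ 2 / (D + lam i) ^ 2) with hf
      obtain ⟨i₀, hi₀⟩ := Finite.exists_min f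
      refine ⟨f i₀, ?_, fun i => ⟨(hi₀ i).trans (min_le_left _ _), (hi₀ i).trans (min_le_right _ _)⟩⟩
      have := hlam i₀
      exact lt_min (by positivity) (by positivity)
    obtain ⟨i₁, hi₁⟩ := Finite.exists_max lam
    have hev : ∀ᶠ n in atTop, (∀ i, (lmin ≤ coefA (X n ω) (lam i) ∧
        coefA (X n ω) (lam i) ≤ lam i₁ / 4) ∧ lmin ≤ coefB (X n ω) (lam i) ∧
        coefB (X n ω) (lam i) ≤ 1) ∧
        κ ≤ |coefA (X n ω) (lam j) * coefB (X n ω) (lam 0) -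
          coefA (X n ω) (lam 0) * coefB (X n ω) (lam j)| := by
      filter_upwards [h3, eventually_lt_of_limsup_lt h2, eventually_gt_atTop 0] with n hn hn2 hn0
      have heig : ∀ i, companionEigenvalue (X n ω) i ≤ D := fun i =>
        (companionEigenvalue_le_of_maxSingularValue_lt hn2 i).trans (by rw [hD]; linarith)
      refine ⟨fun i => ⟨⟨(hle i).1.trans (le_coefA hn0 (hlam i) hD0 heig hc hn), ?_⟩,
        (hle i).2.trans (le_coefB _ hn0 (hlam i) heig), coefB_le _ hn0 (hlam i)⟩,
        hcross _ hn0 heig hn⟩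
      exact (coefA_le _ hn0 (pos_of_le_variance_div hc hn) (hlam i)).trans (by linarith [hi₁ i])
    constructor
    -- The same slope lemma with a and b exchanged; the determinant only changes sign.
    · refine tendsto_slope (a := fun n i => coefB (X n ω) (lam i))
        (b := fun n i => coefA (X n ω) (lam i)) (t := fun n i => trainError (X n ω) (y n ω) (lam i))
        (ρ := σ ^ 2) (fun i => by simpa only [add_comm] using h1 i) hlmin hκ (j := j)
        (a₁ := 1) (b₁ := lam i₁ / 4) ?_
      filter_upwards [hev] with n hn
      refine ⟨fun i => ⟨(hn.1 i).2.1, (hn.1 i).2.2, coefA_nonneg _ (hlam i), (hn.1 i).1.2⟩, ?_⟩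
      rw [abs_sub_comm, mul_comm (coefB _ _), mul_comm (coefB _ _)]
      exact hn.2
    · refine tendsto_slope (a := fun n i => coefA (X n ω) (lam i))
        (b := fun n i => coefB (X n ω) (lam i)) (t := fun n i => trainError (X n ω) (y n ω) (lam i))
        (ρ := r ^ 2) h1 hlmin hκ (j := j) (a₁ := lam i₁ / 4) (b₁ := 1) ?_
      filter_upwards [hev] with n hn
      exact ⟨fun i => ⟨(hn.1 i).1.1, (hn.1 i).1.2, coefB_nonneg _ (hlam i), (hn.1 i).2.2⟩, hn.2⟩
  exact ⟨hmain.mono fun ω h => h.1, hmain.mono fun ω h => h.2⟩
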